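/- Let $S$ and $P$ be two qubits, and let $E$ be an environment of $N$ harmonic oscillators with frequencies $\omega_i>0$, annihilation operators $b_i$ and real couplings $g_i$, initially in the thermal state $\rho_E=e^{-\beta H_E}/\mathrm{Tr}\,e^{-\beta H_E}$, $0<\beta<\infty$. Let $$H_E=\sum_{i=1}^N\hbar\omega_i\bigl(b_i^\dagger b_i+\tfrac12\bigr),\qquad H_{ET}=\sum_{i=1}^N A_T\otimes g_i(b_i+b_i^\dagger),\qquad X(t)=e^{-i(H_E+H_{ET})t/\hbar},$$ where $A_T$ is a Hermitian operator on $\mathbb C^2\otimes\mathbb C^2$ (the space of $S+P$), and let $\rho_S(t)=\mathrm{Tr}_P\mathrm{Tr}_E\bigl(X(t)\,\rho_S\otimes\rho_P\otimes\rho_E\,X(t)^\dagger\bigr)$. Let $\mathcal P_S$ be the set of density matrices of $S$. For $\rho_S\in\mathcal P_S$, let $\mathcal R_T(\rho_S)$ be the set of all states $\rho_S(t)$, $0\le t\le T$, obtained as $\rho_P$ runs over all density matrices of $P$. $S$ is called accessible if for every $T>0$ and every $\rho_S\in\mathcal P_S$ the set $\mathcal R_T(\rho_S)$ contains a nonempty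 (relatively) open subset of $\mathcal P_S$. Suppose that there are orthonormal bases $\{u_1,u_2\}$ and $\{v_1,v_2\}$ of the Hilbert spaces of $S$ and $P$ such that the Bell states $$|\alpha_{1,2}\rangle=\tfrac1{\sqrt2}(u_1\otimes v_1\pm u_2\otimes v_2),\qquad |\alpha_{3,4}\rangle=\tfrac1{\sqrt2}(u_1\otimes v_2\pm u_2\otimes v_1)$$ are eigenvectors of $A_T$, $A_T|\alpha_i\rangle=\alpha_i|\alpha_i\rangle$. Write $\rho_S=\frac12(\mathbb I+\vec s_0\cdot\vec\sigma^S)$, $\rho_P=\frac12(\mathbb I+\vec p\cdot\vec\sigma^P)$, with $\vec s_0=(s_x,s_y,s_z)$ and $\vec p$ in the closed unit ball of $\mathbb R^3$ and with the Pauli operators taken in these bases. Put $\gamma_{ij}(t)=e^{-(\alpha_i-\alpha_j)^2f(t)+i(\alpha_i^2-\alpha_j^2)\varphi(t)}$, where $$f(t)=\sum_{i=1}^N\Bigl(\frac{g_i}{\hbar\omega_i}\Bigr)^2(1+2\bar n_i)(1-\cos\omega_it),\qquad \varphi(t)=\sum_{i=1}^N\Bigl(\frac{g_i}{\hbar\omega_i}\Bigr)^2(\omega_it-\sin\omega_it),\qquad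 \bar n_i=\frac1{e^{\beta\hbar\omega_i}-1},$$ and $\gamma_{ij\pm kl}=\gamma_{ij}\pm\gamma_{kl}$. Then: 1. For all $t\in\mathbb R$, $\rho_S(t)=\frac12(\mathbb I+\vec s(t)\cdot\vec\sigma^S)$ with $\vec s(t)=A(t,\vec s_0)\,\vec p+\vec a(t,\vec s_0)$, where $$A(t,\vec s_0)=\frac12\,\mathrm{Im}\begin{pmatrix} i\gamma_{13-24}(t)&s_z\gamma_{13-24}(t)&s_y\gamma_{13+24}(t)\\ s_z\gamma_{14-23}(t)&i\gamma_{23-14}(t)&-s_x\gamma_{23+14}(t)\\ -s_y\gamma_{12+34}(t)&s_x\gamma_{34-12}(t)&i\gamma_{12-34}(t)\end{pmatrix},\qquad \vec a(t,\vec s_0)=\frac12\,\mathrm{Re}\begin{pmatrix}s_x\gamma_{13+24}(t)\\ s_y\gamma_{23+14}(t)\\ s_z\gamma_{12+34}(t)\end{pmatrix}.$$ 2. For every $\vec s_0$ in the closed unit ball, the derivatives of order $0,\dots,5$ of $t\mapsto\det A(t,\vec s_0)$ vanish at $t=0$. 3. Suppose that at least one $g_i$ is nonzero and that $(\alpha_2-\alpha_4)^2\ne(\alpha_1-\alpha_3)^2$,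 $(\alpha_1-\alpha_4)^2\ne(\alpha_2-\alpha_3)^2$ and $(\alpha_3-\alpha_4)^2\ne(\alpha_1-\alpha_2)^2$. Then, for every $\vec s_0$ in the closed unit ball, the $6$th derivative of $t\mapsto\det A(t,\vec s_0)$ at $t=0$ is nonzero, and $S$ is accessible. -/

import Mathlib

open scoped Kronecker ComplexOrder

noncomputable section

namespace IncoherentControl

/-! ## Two qubits `S`, `P` and a bath of `N` harmonic oscillators -/

/-- Parameters of the bath: `N` oscillators with angular frequencies `omega i > 0` and coupling
constants `g i`, at inverse temperature `beta = 1 / (k_B T) > 0`. -/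
structure Bath (N : ℕ) where
  hbar : ℝ
  hbar_pos : 0 < hbar
  omega : Fin N → ℝ
  omega_pos : ∀ i, 0 < omega i
  g : Fin N → ℝ
  beta : ℝ
  beta_pos : 0 < beta

/-- Index of the product basis of `ℂ² ⊗ ℂ²`; the first factor is `S`, the second one `P`. -/
abbrev SP : Type := Fin 2 × Fin 2

/-- Occupation numbers of the `N` oscillators: they label the orthonormal basis of number states
of the Hilbert space of the bath. -/
abbrev Occ (N : ℕ) : Type := Fin N → ℕ

/-- The Hilbert space `ℂ² ⊗ ℂ² ⊗ ℓ²(ℕ^N)` of `S + P + E`, in the basis `|a⟩ ⊗ |n⟩`. -/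
abbrev Total (N : ℕ) : Type := lp (fun _ : SP × Occ N => ℂ) 2

/-- The basis vector `|a⟩ ⊗ |n⟩`. -/
def ket {N : ℕ} (x : SP × Occ N) : Total N := lp.single 2 x (1 : ℂ)

/-- The dense subspace of finite linear combinations of the vectors `|a⟩ ⊗ |n⟩`, on which the
(unbounded) Hamiltonian is written down. -/
abbrev Core (N : ℕ) : Type := (SP × Occ N) →₀ ℂ

/-- The inclusion of the dense subspace in the Hilbert space. -/
def embed (N : ℕ) : Core N →ₗ[ℂ] Total N := Finsupp.linearCombination ℂ ket

/-- The annihilation operator `b_i |n⟩ = √n_i |n - 1_i⟩`. -/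
def annihilate {N : ℕ} (i : Fin N) : Core N →ₗ[ℂ] Core N :=
  Finsupp.linearCombination ℂ fun x =>
    Finsupp.single (x.1, Function.update x.2 i (x.2 i - 1)) ((Real.sqrt (x.2 i) : ℝ) : ℂ)

/-- The creation operator `b_i† |n⟩ = √(n_i + 1) |n + 1_i⟩`. -/
def create {N : ℕ} (i : Fin N) : Core N →ₗ[ℂ] Core N :=
  Finsupp.linearCombination ℂ fun x =>
    Finsupp.single (x.1, Function.update x.2 i (x.2 i + 1)) ((Real.sqrt (x.2 i + 1) : ℝ) : ℂ)

/-- The operator `A ⊗ 1_E`, for a matrix `A` on `S + P`. -/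
def onSP {N : ℕ} (A : Matrix SP SP ℂ) : Core N →ₗ[ℂ] Core N :=
  Finsupp.linearCombination ℂ fun x => ∑ a : SP, Finsupp.single (a, x.2) (A a x.1)

/-- `H_E = ∑ i, ħ ω_i (b_i† b_i + 1/2)`. -/
def bathHamiltonian {N : ℕ} (E : Bath N) : Core N →ₗ[ℂ] Core N :=
  ∑ i, ((E.hbar * E.omega i : ℝ) : ℂ) •
    (create i ∘ₗ annihilate i + (1 / 2 : ℂ) • LinearMap.id)

/-- `H_ET = ∑ i, A_T ⊗ g_i (b_i + b_i†)`. -/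
def couplingHamiltonian {N : ℕ} (E : Bath N) (AT : Matrix SP SP ℂ) : Core N →ₗ[ℂ] Core N :=
  ∑ i, (E.g i : ℂ) • (onSP AT ∘ₗ (annihilate i + create i))

/-- The full Hamiltonian `H = H_E + H_ET`; the free Hamiltonian of `S + P` is zero. -/
def hamiltonian {N : ℕ} (E : Bath N) (AT : Matrix SP SP ℂ) : Core N →ₗ[ℂ] Core N :=
  bathHamiltonian E + couplingHamiltonian E AT

/-- `X t = exp (-i H t / ħ)`: the one-parameter unitary group whose generator extends
`-(i / ħ) H` on the finite linear combinations of number states. All of these are analytic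
vectors of the symmetric operator `H` (for `AT` Hermitian), which therefore is essentially
self-adjoint, so that there is exactly one such group. -/
structure IsPropagator {N : ℕ} (E : Bath N) (AT : Matrix SP SP ℂ)
    (X : ℝ → Total N →L[ℂ] Total N) : Prop where
  unitary : ∀ t, X t ∈ unitary (Total N →L[ℂ] Total N)
  add : ∀ s t, X (s + t) = X s * X t
  hasDerivAt : ∀ ψ : Core N, HasDerivAt (fun t => X t (embed N ψ))
    ((-(Complex.I / (E.hbar : ℂ))) • embed N (hamiltonian E AT ψ)) 0

/-- Energy `∑ i, ħ ω_i (n_i + 1/2)` of the number state `|n⟩` of the bath. -/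
def energy {N : ℕ} (E : Bath N) (n : Occ N) : ℝ :=
  ∑ i, E.hbar * E.omega i * ((n i : ℝ) + 1 / 2)

/-- Weight of `|n⟩` in the thermal state `ρ_E = exp (-β H_E) / Tr exp (-β H_E)`. -/
def thermalWeight {N : ℕ} (E : Bath N) (n : Occ N) : ℝ :=
  Real.exp (-E.beta * energy E n) / ∑' m : Occ N, Real.exp (-E.beta * energy E m)

/-- The operator `ρ ⊗ ρ_E`, for a matrix `ρ` on `S + P` and the thermal state `ρ_E` of the bath
(a series that converges absolutely in operator norm). -/
def initialState {N : ℕ} (E : Bath N) (ρ : Matrix SP SP ℂ) : Total N →L[ℂ] Total N :=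
  ∑' n : Occ N, (thermalWeight E n : ℂ) •
    ∑ a : SP, ∑ b : SP, ρ a b • InnerProductSpace.rankOne ℂ (ket (a, n)) (ket (b, n))

/-- Partial trace over the bath. -/
def traceE {N : ℕ} (R : Total N →L[ℂ] Total N) : Matrix SP SP ℂ :=
  Matrix.of fun a b => ∑' n : Occ N, inner ℂ (ket (a, n)) (R (ket (b, n)))

/-- Partial trace over the probe `P`. -/
def traceP (M : Matrix SP SP ℂ) : Matrix (Fin 2) (Fin 2) ℂ :=
  Matrix.of fun i j => ∑ k : Fin 2, M (i, k) (j, k)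

/-- The state of `S` at time `t`,
`ρ_S(t) = Tr_P Tr_E (X(t) (ρ_S ⊗ ρ_P ⊗ ρ_E) X(t)†)`. -/
def evolve {N : ℕ} (E : Bath N) (X : ℝ → Total N →L[ℂ] Total N) (t : ℝ)
    (ρS ρP : Matrix (Fin 2) (Fin 2) ℂ) : Matrix (Fin 2) (Fin 2) ℂ :=
  traceP (traceE (X t * initialState E (ρS ⊗ₖ ρP) * star (X t)))

/-! ## Reachable sets and accessibility -/

/-- The density matrices of a qubit. -/
def densityMatrices : Set (Matrix (Fin 2) (Fin 2) ℂ) :=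
  {ρ | ρ.PosSemidef ∧ ρ.trace = 1}

/-- The states of `S` that are reached from `ρS` at time `t`; the control is the initial state of
the probe, an arbitrary density matrix. -/
def reachableAt {N : ℕ} (E : Bath N) (X : ℝ → Total N →L[ℂ] Total N)
    (ρS : Matrix (Fin 2) (Fin 2) ℂ) (t : ℝ) : Set (Matrix (Fin 2) (Fin 2) ℂ) :=
  {ρ | ∃ ρP ∈ densityMatrices, ρ = evolve E X t ρS ρP}

/-- The states of `S` that are reached from `ρS` at some time in `[0, T]`. -/
def reachableUntil {N : ℕ} (E : Bath N) (X : ℝ → Total N →L[ℂ] Total N)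
    (ρS : Matrix (Fin 2) (Fin 2) ℂ) (T : ℝ) : Set (Matrix (Fin 2) (Fin 2) ℂ) :=
  ⋃ t ∈ Set.Icc 0 T, reachableAt E X ρS t

/-- `S` is accessible: for every `T > 0` and every initial state, the set of states that are
reached until `T` contains a nonempty set that is open in the space of density matrices. -/
def IsAccessible {N : ℕ} (E : Bath N) (X : ℝ → Total N →L[ℂ] Total N) : Prop :=
  ∀ T : ℝ, 0 < T → ∀ ρS ∈ densityMatrices,
    ∃ O : Set (Matrix (Fin 2) (Fin 2) ℂ), IsOpen O ∧ (O ∩ densityMatrices).Nonempty ∧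
      O ∩ densityMatrices ⊆ reachableUntil E X ρS T

/-! ## Bell states and coherence vectors -/

/-- An orthonormal basis of the Hilbert space `ℂ²` of a qubit. -/
abbrev QubitBasis : Type := OrthonormalBasis (Fin 2) ℂ (EuclideanSpace ℂ (Fin 2))

/-- The product vector `|v⟩ ⊗ |w⟩`. -/
def tensorVec (v w : EuclideanSpace ℂ (Fin 2)) : SP → ℂ := fun a => v a.1 * w a.2

/-- The four Bell states of the bases `u` of `S` and `v` of `P`, in the order
`(u₁v₁ + u₂v₂)/√2`, `(u₁v₁ - u₂v₂)/√2`, `(u₁v₂ + u₂v₁)/√2`, `(u₁v₂ - u₂v₁)/√2`. -/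
def bell (u v : QubitBasis) : Fin 4 → SP → ℂ :=
  ![((1 / Real.sqrt 2 : ℝ) : ℂ) • (tensorVec (u 0) (v 0) + tensorVec (u 1) (v 1)),
    ((1 / Real.sqrt 2 : ℝ) : ℂ) • (tensorVec (u 0) (v 0) - tensorVec (u 1) (v 1)),
    ((1 / Real.sqrt 2 : ℝ) : ℂ) • (tensorVec (u 0) (v 1) + tensorVec (u 1) (v 0)),
    ((1 / Real.sqrt 2 : ℝ) : ℂ) • (tensorVec (u 0) (v 1) - tensorVec (u 1) (v 0))]

/-- The Pauli matrices `σ_x`, `σ_y`, `σ_z`. -/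
def pauli : Fin 3 → Matrix (Fin 2) (Fin 2) ℂ :=
  ![!![0, 1; 1, 0], !![0, -Complex.I; Complex.I, 0], !![1, 0; 0, -1]]

/-- The Pauli operators with respect to the basis `u`: `∑ i j, (σ_k)_ij |u_i⟩⟨u_j|`. -/
def pauliIn (u : QubitBasis) (k : Fin 3) : Matrix (Fin 2) (Fin 2) ℂ :=
  ∑ i, ∑ j, pauli k i j • Matrix.of fun a b => u i a * star (u j b)

/-- The matrix `(1 + s · σ) / 2` with coherence vector `s`, with respect to the basis `u`. -/
def ofBloch (u : QubitBasis) (s : Fin 3 → ℝ) : Matrix (Fin 2) (Fin 2) ℂ :=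
  (1 / 2 : ℂ) • (1 + ∑ k, (s k : ℂ) • pauliIn u k)

/-- The coherence vectors of the states of a qubit: the closed unit ball of Euclidean `ℝ³`. -/
def blochBall : Set (Fin 3 → ℝ) := {s | ∑ k, s k ^ 2 ≤ 1}

/-! ## The affine form of the evolution -/

/-- Average thermal occupation number of the `i`-th oscillator. -/
def meanOccupation {N : ℕ} (E : Bath N) (i : Fin N) : ℝ :=
  1 / (Real.exp (E.beta * E.hbar * E.omega i) - 1)

/-- `f(t) = ∑ i, (g_i / ħω_i)² (1 + 2 n̄_i) (1 - cos ω_i t)`. -/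
def decay {N : ℕ} (E : Bath N) (t : ℝ) : ℝ :=
  ∑ i, (E.g i / (E.hbar * E.omega i)) ^ 2 * (1 + 2 * meanOccupation E i) *
    (1 - Real.cos (E.omega i * t))

/-- `φ(t) = ∑ i, (g_i / ħω_i)² (ω_i t - sin ω_i t)`. -/
def phase {N : ℕ} (E : Bath N) (t : ℝ) : ℝ :=
  ∑ i, (E.g i / (E.hbar * E.omega i)) ^ 2 * (E.omega i * t - Real.sin (E.omega i * t))

/-- `γ_ij(t) = exp (-(α_i - α_j)² f(t) + i (α_i² - α_j²) φ(t))`; the indices run over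
`0, 1, 2, 3` instead of `1, 2, 3, 4`. -/
def gam {N : ℕ} (E : Bath N) (α : Fin 4 → ℝ) (i j : Fin 4) (t : ℝ) : ℂ :=
  Complex.exp (((-(α i - α j) ^ 2 * decay E t : ℝ) : ℂ) +
    Complex.I * (((α i ^ 2 - α j ^ 2) * phase E t : ℝ) : ℂ))

/-- The matrix `A(t, s)`. -/
def affineMatrix {N : ℕ} (E : Bath N) (α : Fin 4 → ℝ) (t : ℝ) (s : Fin 3 → ℝ) :
    Matrix (Fin 3) (Fin 3) ℝ :=
  let γ : Fin 4 → Fin 4 → ℂ := fun i j => gam E α i j t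
  let x : ℂ := s 0
  let y : ℂ := s 1
  let z : ℂ := s 2
  let I : ℂ := Complex.I
  (1 / 2 : ℝ) • (!![I * (γ 0 2 - γ 1 3), z * (γ 0 2 - γ 1 3), y * (γ 0 2 + γ 1 3);
                    z * (γ 0 3 - γ 1 2), I * (γ 1 2 - γ 0 3), -x * (γ 1 2 + γ 0 3);
                    -y * (γ 0 1 + γ 2 3), x * (γ 2 3 - γ 0 1), I * (γ 0 1 - γ 2 3)] :
      Matrix (Fin 3) (Fin 3) ℂ).map Complex.im

/-- The vector `a(t, s)`. -/
def affineVector {N : ℕ} (E : Bath N) (α : Fin 4 → ℝ) (t : ℝ) (s : Fin 3 → ℝ) : Fin 3 → ℝ :=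
  let γ : Fin 4 → Fin 4 → ℂ := fun i j => gam E α i j t
  ![(1 / 2) * s 0 * (γ 0 2 + γ 1 3).re,
    (1 / 2) * s 1 * (γ 1 2 + γ 0 3).re,
    (1 / 2) * s 2 * (γ 0 1 + γ 2 3).re]

end IncoherentControl

end

open scoped Kronecker ComplexOrder

namespace IncoherentControl

/-! ## Uniqueness for infinite hierarchies of differential equations -/

section Hierarchy

variable {ι G : Type*} [NormedAddCommGroup G] [NormedSpace ℝ G]

/-! In the Bell basis `A_T` is diagonal, so the Hamiltonian splits into four displaced copies `H_E +
α_i ∑ g_k (b_k + b_k†)` of the bath Hamiltonian. The evolution therefore multiplies each Bell-basis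
entry `(i, j)` of the initial state of `S + P` by the thermal average of the overlap of two bath
branches, and the physical content is that this average equals `γ_ij(t)`.

The propagator is known only through its derivative on finite combinations of number states. Its
matrix elements solve an infinite linear system that couples neighbouring levels, with coefficients
growing at most linearly in the number of excitations; solutions of at most linear growth are unique
(`eq_zero_of_hierarchy`). Uniqueness shows that Bell components do not mix
(`bellSlice_propagator_of_ne`) and that moving a ladder operator from one branch to the other costs
only a scalar displacement (`IsOverlap.raise_left`). Together with the Boltzmann relation between
thermal weights of neighbouring number states, this closes the derivative of the thermal overlap
into a scalar linear equation (`IsOverlap.hasDerivAt_thermalOverlap`), solved by the exponential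
`γ_ij`.

The affine form is then a finite matrix computation (`traceP_bellSigns`, `evolve_ofBloch`). Since
`f` starts at order `t²` and `φ` at order `t³`, the diagonal of `A` has order `t²` and the rest
order `t³`, so `det A = t⁶ h(t)` with `h(0)` coming from the diagonal alone
(`exists_det_affineMatrix_eq`). When `h(0) ≠ 0`, the map `p ↦ A p + a` is invertible at arbitrarily
small positive times, and the image of the open ball supplies the open set (`isAccessible`). -/

/-- The iterated bound for a family of functions whose derivatives are controlled by the members of
the family one level higher. -/
theorem norm_le_of_hierarchy {deg : ι → ℕ} {F F' : ι → ℝ → G} {C : ℝ} (hC : 0 ≤ C)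
    (hF : ∀ x t, HasDerivAt (F x) (F' x t) t)
    (hF' : ∀ x t B, (∀ y, deg y ≤ deg x + 1 → ‖F y t‖ ≤ B) → ‖F' x t‖ ≤ C * (deg x + 1) * B)
    (hb : ∀ x t, ‖F x t‖ ≤ C * (deg x + 1)) {t₀ : ℝ} (h0 : ∀ x, F x t₀ = 0) (K : ℕ) :
    ∀ x t, t₀ ≤ t →
      ‖F x t‖ ≤ C * (deg x + K + 1) * (C * (t - t₀)) ^ K * ((deg x + K).choose K : ℝ) := by
  induction K with
  | zero => intro x t _; simpa using hb x t
  | succ K ih =>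
    intro x t ht
    set c : ℝ := C * (deg x + 1) *
      (C * (deg x + 1 + K + 1) * C ^ K * ((deg x + 1 + K).choose K : ℝ)) with hc
    have hd : ∀ τ, t₀ ≤ τ → ‖F' x τ‖ ≤ c * (τ - t₀) ^ K := by
      intro τ hτ
      have h0' : 0 ≤ τ - t₀ := sub_nonneg.2 hτ
      refine (hF' x τ (C * (deg x + 1 + K + 1) * (C * (τ - t₀)) ^ K *
        ((deg x + 1 + K).choose K : ℝ)) ?_).trans (le_of_eq ?_)
      · intro y hy
        refine (ih y τ hτ).trans ?_
        have h1 : (deg y : ℝ) ≤ deg x + 1 := by exact_mod_cast hy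
        have h2 : ((deg y + K).choose K : ℝ) ≤ (deg x + 1 + K).choose K := by
          exact_mod_cast Nat.choose_le_choose K (by omega)
        gcongr
      · rw [hc, mul_pow]; ring
    -- The comparison function is the antiderivative of the bound `hd`. Each round gains a power of
    -- `t - t₀` and a factor `(deg x + 1) / (K + 1)`, which `hch` absorbs into the binomial
    -- coefficient.
    have key := image_norm_le_of_norm_deriv_right_le_deriv_boundary (a := t₀) (b := t) (f := F x)
      (f' := F' x) (B := fun τ => c * (τ - t₀) ^ (K + 1) / (K + 1))
      (B' := fun τ => c * (τ - t₀) ^ K)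
      (fun τ _ => (hF x τ).continuousAt.continuousWithinAt)
      (fun τ _ => (hF x τ).hasDerivWithinAt) (by simp [h0 x])
      (fun τ => by
        have h := ((((hasDerivAt_id τ).sub_const t₀).fun_pow (K + 1)).const_mul c).div_const
          ((K : ℝ) + 1)
        refine h.congr_deriv ?_
        have : (K : ℝ) + 1 ≠ 0 := by positivity
        simp; field_simp)
      (fun τ hτ => hd τ hτ.1) (Set.right_mem_Icc.2 ht)
    refine key.trans (le_of_eq ?_)
    have hch : (((deg x + (K + 1)).choose (K + 1) : ℕ) : ℝ) * (K + 1) =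
        ((deg x + 1 + K).choose K : ℕ) * (deg x + 1) := by
      have := Nat.choose_succ_right_eq (deg x + 1 + K) K
      rw [show deg x + 1 + K - K = deg x + 1 by omega] at this
      rw [show deg x + (K + 1) = deg x + 1 + K by omega]
      exact_mod_cast this
    have hK : (K : ℝ) + 1 ≠ 0 := by positivity
    rw [div_eq_iff hK, hc, mul_pow]
    push_cast
    linear_combination (-(C * (deg x + (K + 1) + 1) * (C ^ (K + 1) * (t - t₀) ^ (K + 1)))) * hch

/-- Within time `1 / (4 * C)` after a common zero the iterated bound is `O(K * 2⁻ᴷ)`, because the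
binomial coefficient is at most `2 ^ (deg x + K)`; letting `K → ∞` kills every member. The step
length depends neither on the level nor on the starting time, so finitely many steps reach any `t ≥
0`. -/
theorem eq_zero_of_hierarchy_forward {deg : ι → ℕ} {F F' : ι → ℝ → G} {C : ℝ} (hC : 0 < C)
    (hF : ∀ x t, HasDerivAt (F x) (F' x t) t)
    (hF' : ∀ x t B, (∀ y, deg y ≤ deg x + 1 → ‖F y t‖ ≤ B) → ‖F' x t‖ ≤ C * (deg x + 1) * B)
    (hb : ∀ x t, ‖F x t‖ ≤ C * (deg x + 1)) (h0 : ∀ x, F x 0 = 0) (x : ι) (t : ℝ) (ht : 0 ≤ t) :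
    F x t = 0 := by
  have step : ∀ t₀ : ℝ, (∀ x, F x t₀ = 0) → ∀ x t, t₀ ≤ t → t ≤ t₀ + 1 / (4 * C) → F x t = 0 := by
    intro t₀ h x t h1 h2
    have hle : ∀ K : ℕ, ‖F x t‖ ≤
        C * 2 ^ deg x * ((deg x + 1) * (1 / 2) ^ K + K * (1 / 2 : ℝ) ^ K) := by
      intro K
      refine (norm_le_of_hierarchy hC.le hF hF' hb h K x t h1).trans ?_
      have h3 : C * (t - t₀) ≤ 1 / 4 := by
        have : t - t₀ ≤ 1 / (4 * C) := by linarith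
        calc C * (t - t₀) ≤ C * (1 / (4 * C)) := by gcongr
          _ = 1 / 4 := by field_simp
      have h4 : ((deg x + K).choose K : ℝ) ≤ 2 ^ (deg x + K) := by
        exact_mod_cast Nat.choose_le_two_pow _ _
      have h5 : 0 ≤ C * (t - t₀) := mul_nonneg hC.le (sub_nonneg.2 h1)
      calc C * (deg x + K + 1) * (C * (t - t₀)) ^ K * ((deg x + K).choose K : ℝ)
          ≤ C * (deg x + K + 1) * (1 / 4) ^ K * 2 ^ (deg x + K) := by gcongr
        _ = _ := by
          rw [show (1 / 4 : ℝ) = 1 / 2 * (1 / 2) by norm_num, mul_pow, pow_add]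
          have : (1 / 2 : ℝ) ^ K * 2 ^ K = 1 := by rw [← mul_pow]; norm_num
          linear_combination (C * (deg x + K + 1) * (1 / 2) ^ K * 2 ^ deg x) * this
    have hlim : Filter.Tendsto (fun K : ℕ =>
        C * 2 ^ deg x * (((deg x : ℝ) + 1) * (1 / 2) ^ K + K * (1 / 2 : ℝ) ^ K))
        Filter.atTop (nhds 0) := by
      have e1 := tendsto_pow_atTop_nhds_zero_of_lt_one (r := (1 / 2 : ℝ)) (by norm_num) (by norm_num)
      have e2 := tendsto_self_mul_const_pow_of_lt_one (r := (1 / 2 : ℝ)) (by norm_num) (by norm_num)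
      simpa using ((e1.const_mul ((deg x : ℝ) + 1)).add e2).const_mul (C * 2 ^ deg x)
    exact norm_le_zero_iff.1 (ge_of_tendsto' hlim hle)
  have hn : ∀ n : ℕ, ∀ x t, 0 ≤ t → t ≤ n * (1 / (4 * C)) → F x t = 0 := by
    intro n
    induction n with
    | zero =>
      intro x t h1 h2
      obtain rfl : t = 0 := le_antisymm (by simpa using h2) h1
      exact h0 x
    | succ n ih =>
      intro x t h1 h2
      have hp : 0 ≤ (n : ℝ) * (1 / (4 * C)) := by positivity
      rcases le_total t (n * (1 / (4 * C))) with h | h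
      · exact ih x t h1 h
      · refine step _ (fun y => ih y _ hp le_rfl) x t h ?_
        push_cast at h2; linarith
  obtain ⟨n, hn'⟩ := exists_nat_ge (t / (1 / (4 * C)))
  exact hn n x t ht ((div_le_iff₀ (by positivity)).1 hn')

/-- A family of functions that vanishes at `0` and whose derivatives are controlled, with at most
linear growth, by the members of the family one level higher vanishes identically. -/
theorem eq_zero_of_hierarchy {deg : ι → ℕ} {F F' : ι → ℝ → G} {C : ℝ} (hC : 0 < C)
    (hF : ∀ x t, HasDerivAt (F x) (F' x t) t)
    (hF' : ∀ x t B, (∀ y, deg y ≤ deg x + 1 → ‖F y t‖ ≤ B) → ‖F' x t‖ ≤ C * (deg x + 1) * B)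
    (hb : ∀ x t, ‖F x t‖ ≤ C * (deg x + 1)) (h0 : ∀ x, F x 0 = 0) (x : ι) (t : ℝ) :
    F x t = 0 := by
  rcases le_total 0 t with ht | ht
  · exact eq_zero_of_hierarchy_forward hC hF hF' hb h0 x t ht
  -- The hypotheses are invariant under time reversal.
  · have := eq_zero_of_hierarchy_forward (F := fun x t => F x (-t)) (F' := fun x t => -F' x (-t)) hC
      (fun x t => by
        simpa [Function.comp_def] using (hF x (-t)).scomp t (hasDerivAt_neg t))
      (fun x t B h => by simpa using hF' x (-t) B h) (fun x t => hb x (-t)) (by simpa using h0) x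
      (-t) (by linarith)
    simpa using this

end Hierarchy

/-! ## Sums over occupation numbers -/

/-- Every finite set of occupation numbers lies in a box, over which the sum of products is the
product of the single-mode sums. -/
theorem summable_prod_pi {N : ℕ} {f : Fin N → ℕ → ℝ} (h0 : ∀ k n, 0 ≤ f k n)
    (hf : ∀ k, Summable (f k)) : Summable fun n : Occ N => ∏ k, f k (n k) := by
  refine summable_of_sum_le (c := ∏ k, ∑' n, f k n)
    (fun n => Finset.prod_nonneg fun k _ => h0 k _) fun s => ?_
  calc ∑ n ∈ s, ∏ k, f k (n k)
      ≤ ∑ n ∈ Fintype.piFinset fun k => s.image fun n => n k, ∏ k, f k (n k) := by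
        refine Finset.sum_le_sum_of_subset_of_nonneg (fun n hn => ?_)
          fun n _ _ => Finset.prod_nonneg fun k _ => h0 k _
        exact Fintype.mem_piFinset.2 fun k => Finset.mem_image_of_mem _ hn
    _ = ∏ k, ∑ j ∈ s.image fun n => n k, f k j := (Finset.prod_univ_sum _ _).symm
    _ ≤ ∏ k, ∑' n, f k n := Finset.prod_le_prod
        (fun k _ => Finset.sum_nonneg fun j _ => h0 k _)
        fun k _ => (hf k).sum_le_tsum _ fun j _ => h0 k j

/-- The total number of excitations. -/
def excitations {N : ℕ} (n : Occ N) : ℕ := ∑ k, n k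

/-- Dominates the weight `excitations n + 1` by a product over the modes, so that `summable_prod_pi`
applies. -/
theorem one_add_sum_le_prod {N : ℕ} (n : Occ N) (s : Finset (Fin N)) :
    1 + ∑ k ∈ s, (n k : ℝ) ≤ ∏ k ∈ s, (1 + (n k : ℝ)) := by
  induction s using Finset.induction_on with
  | empty => simp
  | insert k s hk ih =>
    rw [Finset.sum_insert hk, Finset.prod_insert hk]
    have h1 : 0 ≤ ∑ k ∈ s, (n k : ℝ) := Finset.sum_nonneg fun _ _ => by positivity
    have h2 : (0 : ℝ) ≤ n k := by positivity
    nlinarith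

/-! ### Boltzmann factors and thermal weights. -/

variable {N : ℕ} (E : Bath N)

/-- The Boltzmann factor of a single quantum in the mode `k`. -/
noncomputable def boltzmann (k : Fin N) : ℝ := Real.exp (-(E.beta * E.hbar * E.omega k))

theorem boltzmann_pos (k : Fin N) : 0 < boltzmann E k := Real.exp_pos _

theorem boltzmann_lt_one (k : Fin N) : boltzmann E k < 1 := by
  have := mul_pos (mul_pos E.beta_pos E.hbar_pos) (E.omega_pos k)
  simpa [boltzmann] using this

theorem meanOccupation_eq (k : Fin N) :
    meanOccupation E k = boltzmann E k / (1 - boltzmann E k) := by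
  have h1 := boltzmann_pos E k
  have h2 := boltzmann_lt_one E k
  have h3 : Real.exp (E.beta * E.hbar * E.omega k) = (boltzmann E k)⁻¹ := by
    rw [boltzmann, Real.exp_neg, inv_inv]
  rw [meanOccupation, h3]
  have : 1 - boltzmann E k ≠ 0 := by linarith
  have h4 : (boltzmann E k)⁻¹ - 1 ≠ 0 := by
    rw [sub_ne_zero]; exact (one_lt_inv₀ h1 |>.2 h2).ne'
  rw [div_eq_div_iff h4 this]
  field_simp

theorem exp_energy_eq (n : Occ N) : Real.exp (-E.beta * energy E n) =
    ∏ k, Real.exp (-(E.beta * E.hbar * E.omega k) / 2) * boltzmann E k ^ n k := by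
  rw [energy, Finset.mul_sum, Real.exp_sum]
  refine Finset.prod_congr rfl fun k _ => ?_
  rw [boltzmann, ← Real.exp_nat_mul, ← Real.exp_add]
  congr 1; ring

/-- The generator raises growth by one power of the number of excitations; this summability later
allows thermal averages to be differentiated term by term. -/
theorem summable_exp_energy_mul :
    Summable fun n : Occ N => Real.exp (-E.beta * energy E n) * (excitations n + 1 : ℝ) := by
  have hs : Summable fun n : Occ N => ∏ k, (Real.exp (-(E.beta * E.hbar * E.omega k) / 2) *
      boltzmann E k ^ n k * (1 + (n k : ℝ))) := by
    refine summable_prod_pi (f := fun k n => Real.exp (-(E.beta * E.hbar * E.omega k) / 2) *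
      boltzmann E k ^ n * (1 + (n : ℝ))) (fun k n => ?_) fun k => ?_
    · have := (boltzmann_pos E k).le
      positivity
    · have h1 : ‖boltzmann E k‖ < 1 := by
        rw [Real.norm_of_nonneg (boltzmann_pos E k).le]; exact boltzmann_lt_one E k
      have h2 := (summable_geometric_of_norm_lt_one h1).add
        (by simpa using summable_pow_mul_geometric_of_norm_lt_one 1 h1)
      refine (h2.mul_left (Real.exp (-(E.beta * E.hbar * E.omega k) / 2))).congr fun n => ?_
      ring
  refine Summable.of_nonneg_of_le (fun n => by positivity) (fun n => ?_) hs
  rw [exp_energy_eq, Finset.prod_mul_distrib (g := fun k => 1 + (n k : ℝ))]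
  refine mul_le_mul_of_nonneg_left ?_ (Finset.prod_nonneg fun k _ => ?_)
  · have := one_add_sum_le_prod n Finset.univ
    rw [excitations]; push_cast; linarith
  · have := (boltzmann_pos E k).le
    positivity

theorem summable_exp_energy : Summable fun n : Occ N => Real.exp (-E.beta * energy E n) := by
  refine Summable.of_nonneg_of_le (fun _ => (Real.exp_pos _).le) (fun n => ?_)
    (summable_exp_energy_mul E)
  refine le_mul_of_one_le_right (Real.exp_pos _).le ?_
  have : (0 : ℝ) ≤ excitations n := by positivity
  linarith

theorem tsum_exp_energy_pos : 0 < ∑' n : Occ N, Real.exp (-E.beta * energy E n) :=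
  (summable_exp_energy E).tsum_pos (fun _ => (Real.exp_pos _).le) 0 (Real.exp_pos _)

theorem thermalWeight_pos (n : Occ N) : 0 < thermalWeight E n :=
  div_pos (Real.exp_pos _) (tsum_exp_energy_pos E)

theorem summable_thermalWeight_mul :
    Summable fun n : Occ N => thermalWeight E n * (excitations n + 1 : ℝ) :=
  ((summable_exp_energy_mul E).div_const (∑' m : Occ N, Real.exp (-E.beta * energy E m))).congr
    fun n => by rw [thermalWeight]; ring

theorem summable_thermalWeight : Summable (thermalWeight E) :=
  (summable_exp_energy E).div_const _

theorem tsum_thermalWeight : ∑' n, thermalWeight E n = 1 := by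
  simp only [thermalWeight]
  rw [tsum_div_const, div_self (tsum_exp_energy_pos E).ne']

/-! ### Shifts of occupation numbers. -/

/-- Raising the occupation number of the mode `k`. -/
def raise (k : Fin N) (n : Occ N) : Occ N := Function.update n k (n k + 1)

/-- Lowering the occupation number of the mode `k`. -/
def lower (k : Fin N) (n : Occ N) : Occ N := Function.update n k (n k - 1)

theorem lower_raise (k : Fin N) (n : Occ N) : lower k (raise k n) = n := by
  simp [lower, raise]

theorem raise_lower {k : Fin N} {n : Occ N} (h : n k ≠ 0) : raise k (lower k n) = n := by
  simp [lower, raise, Nat.sub_add_cancel (Nat.one_le_iff_ne_zero.2 h)]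

theorem raise_injective (k : Fin N) : Function.Injective (raise (N := N) k) :=
  Function.LeftInverse.injective (lower_raise k)

theorem raise_self (k : Fin N) (n : Occ N) : raise k n k = n k + 1 := by simp [raise]

theorem excitations_raise (k : Fin N) (n : Occ N) :
    excitations (raise k n) = excitations n + 1 := by
  rw [excitations, excitations, raise, Finset.sum_update_of_mem (Finset.mem_univ k),
    ← Finset.add_sum_erase _ _ (Finset.mem_univ k), Finset.sdiff_singleton_eq_erase]
  omega

theorem excitations_lower_le (k : Fin N) (n : Occ N) : excitations (lower k n) ≤ excitations n := by
  refine Finset.sum_le_sum fun j _ => ?_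
  by_cases h : j = k
  · subst h; simp [lower]
  · simp [lower, h]

theorem le_excitations (k : Fin N) (n : Occ N) : n k ≤ excitations n :=
  Finset.single_le_sum (f := n) (fun _ _ => Nat.zero_le _) (Finset.mem_univ k)

theorem raise_of_ne {k l : Fin N} (h : l ≠ k) (n : Occ N) : raise k n l = n l := by
  simp [raise, h]

theorem energy_raise (k : Fin N) (n : Occ N) :
    energy E (raise k n) = energy E n + E.hbar * E.omega k := by
  rw [energy, energy, ← Finset.add_sum_erase _ _ (Finset.mem_univ k),
    ← Finset.add_sum_erase (a := k) (f := fun i => E.hbar * E.omega i * ((n i : ℝ) + 1 / 2)) _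
      (Finset.mem_univ k), raise_self]
  have : ∀ i ∈ Finset.univ.erase k, E.hbar * E.omega i * ((raise k n i : ℝ) + 1 / 2) =
      E.hbar * E.omega i * ((n i : ℝ) + 1 / 2) := fun i hi => by
    rw [raise_of_ne (Finset.ne_of_mem_erase hi)]
  rw [Finset.sum_congr rfl this]; push_cast; ring

/-- One more quantum in the mode `k` costs the energy `ħ ω_k`. This is the only property specific to
the thermal state that enters the equation for the overlap. -/
theorem thermalWeight_raise (k : Fin N) (n : Occ N) :
    thermalWeight E (raise k n) = boltzmann E k * thermalWeight E n := by
  rw [thermalWeight, thermalWeight, energy_raise, boltzmann, mul_div_assoc', ← Real.exp_add]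
  congr 2; ring

/-- Shifting the summation index: a sum over the number states with `n k ≠ 0`. -/
theorem tsum_eq_tsum_raise (k : Fin N) {f : Occ N → ℂ} (hf : ∀ n, n k = 0 → f n = 0) :
    ∑' n, f n = ∑' n, f (raise k n) := by
  refine ((raise_injective k).tsum_eq fun n hn => ?_).symm
  exact ⟨lower k n, raise_lower fun h => hn (hf n h)⟩

end IncoherentControl

namespace IncoherentControl

variable {N : ℕ}

/-! ## Ladder operators acting on families indexed by number states -/

section Ladder

variable {V : Type*} [AddCommGroup V] [Module ℂ V]

/-- The values of a linear map on `b_k |n⟩`, in terms of its values `f` on the number states. -/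
noncomputable def lowerFam (k : Fin N) (f : Occ N → V) (n : Occ N) : V :=
  ((Real.sqrt (n k) : ℝ) : ℂ) • f (lower k n)

/-- The values of a linear map on `b_k† |n⟩`, in terms of its values `f` on the number states. -/
noncomputable def raiseFam (k : Fin N) (f : Occ N → V) (n : Occ N) : V :=
  ((Real.sqrt (n k + 1) : ℝ) : ℂ) • f (raise k n)

/-- The values of a linear map on `(i / ħ) (H_E + a ∑ k, g_k (b_k + b_k†)) |n⟩`, in terms of its
values `f` on the number states. -/
noncomputable def genFam (E : Bath N) (a : ℝ) (f : Occ N → V) (n : Occ N) : V :=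
  (Complex.I / (E.hbar : ℂ)) • ((energy E n : ℂ) • f n +
    (a : ℂ) • ∑ l, (E.g l : ℂ) • (lowerFam l f n + raiseFam l f n))

theorem genFam_add (E : Bath N) (a : ℝ) (f h : Occ N → V) (n : Occ N) :
    genFam E a (fun n => f n + h n) n = genFam E a f n + genFam E a h n := by
  simp only [genFam, lowerFam, raiseFam, smul_add, Finset.sum_add_distrib]
  abel

theorem genFam_smul (E : Bath N) (a : ℝ) (c : ℂ) (f : Occ N → V) (n : Occ N) :
    genFam E a (fun n => c • f n) n = c • genFam E a f n := by
  simp only [genFam, lowerFam, raiseFam, smul_add, Finset.smul_sum, smul_comm c]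

theorem genFam_sub (E : Bath N) (a : ℝ) (f h : Occ N → V) (n : Occ N) :
    genFam E a (fun n => f n - h n) n = genFam E a f n - genFam E a h n := by
  have := genFam_add E a f (fun n => (-1 : ℂ) • h n) n
  rw [genFam_smul] at this
  simpa [sub_eq_add_neg] using this

theorem raise_comm (k l : Fin N) (n : Occ N) : raise k (raise l n) = raise l (raise k n) := by
  by_cases h : k = l
  · rw [h]
  · simp only [raise, Function.update_of_ne h, Function.update_of_ne (Ne.symm h)]
    exact Function.update_comm (Ne.symm h) _ _ _

theorem lower_comm (k l : Fin N) (n : Occ N) : lower k (lower l n) = lower l (lower k n) := by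
  by_cases h : k = l
  · rw [h]
  · simp only [lower, Function.update_of_ne h, Function.update_of_ne (Ne.symm h)]
    exact Function.update_comm (Ne.symm h) _ _ _

theorem raise_lower_comm {k l : Fin N} (h : k ≠ l) (n : Occ N) :
    raise k (lower l n) = lower l (raise k n) := by
  simp only [raise, lower, Function.update_of_ne h, Function.update_of_ne (Ne.symm h)]
  exact Function.update_comm (Ne.symm h) _ _ _

theorem lower_of_ne {k l : Fin N} (h : l ≠ k) (n : Occ N) : lower k n l = n l := by
  simp [lower, h]

theorem raiseFam_raiseFam (k l : Fin N) (f : Occ N → V) (n : Occ N) :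
    raiseFam k (raiseFam l f) n = raiseFam l (raiseFam k f) n := by
  by_cases h : k = l
  · rw [h]
  · simp only [raiseFam, raise_of_ne h, raise_of_ne (Ne.symm h), raise_comm k l]
    exact smul_comm _ _ _

theorem lowerFam_lowerFam (k l : Fin N) (f : Occ N → V) (n : Occ N) :
    lowerFam k (lowerFam l f) n = lowerFam l (lowerFam k f) n := by
  by_cases h : k = l
  · rw [h]
  · simp only [lowerFam, lower_of_ne h, lower_of_ne (Ne.symm h), lower_comm k l]
    exact smul_comm _ _ _

/-- The canonical commutation relation `[b_l, b_k†] = δ_kl`. The families record values at ladder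
operators applied to `|n⟩`, so the order of composition is reversed. -/
theorem raiseFam_lowerFam (k l : Fin N) (f : Occ N → V) (n : Occ N) :
    raiseFam k (lowerFam l f) n = lowerFam l (raiseFam k f) n + if l = k then f n else 0 := by
  by_cases h : l = k
  · subst h
    have h1 : raiseFam l (lowerFam l f) n = ((n l : ℂ) + 1) • f n := by
      simp only [raiseFam, lowerFam, lower_raise, raise_self, smul_smul]
      congr 1
      rw [← Complex.ofReal_mul]; push_cast
      rw [← Complex.ofReal_mul, Real.mul_self_sqrt (by positivity)]
      push_cast; rfl
    have h2 : lowerFam l (raiseFam l f) n = (n l : ℂ) • f n := by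
      by_cases h0 : n l = 0
      · simp [lowerFam, h0]
      · have h3 : (lower l n l : ℝ) + 1 = n l := by
          rw [← Nat.cast_succ]; congr 1
          simp [lower]; omega
        simp only [raiseFam, lowerFam, raise_lower h0, smul_smul, h3]
        rw [← Complex.ofReal_mul, Real.mul_self_sqrt (by positivity)]
        norm_cast
    rw [h1, h2, add_smul, one_smul, if_pos rfl]
  · simp only [raiseFam, lowerFam, raise_of_ne h, lower_of_ne (Ne.symm h),
      raise_lower_comm (Ne.symm h), if_neg h, add_zero]
    exact smul_comm _ _ _

theorem hbar_ne_zero (E : Bath N) : (E.hbar : ℂ) ≠ 0 := Complex.ofReal_ne_zero.2 E.hbar_pos.ne'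

theorem omega_ne_zero (E : Bath N) (k : Fin N) : (E.omega k : ℂ) ≠ 0 :=
  Complex.ofReal_ne_zero.2 (E.omega_pos k).ne'

/-- This is `[H, b_k†] = ħ ω_k b_k† + a g_k` multiplied by `i / ħ`. -/
theorem raiseFam_genFam (E : Bath N) (a : ℝ) (k : Fin N) (f : Occ N → V) (n : Occ N) :
    raiseFam k (genFam E a f) n = genFam E a (raiseFam k f) n +
      (Complex.I * E.omega k) • raiseFam k f n + (Complex.I * a * E.g k / E.hbar) • f n := by
  have h1 : raiseFam k (genFam E a f) n = (Complex.I / (E.hbar : ℂ)) •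
      (((energy E (raise k n) : ℝ) : ℂ) • raiseFam k f n + (a : ℂ) • ∑ l, (E.g l : ℂ) •
        (raiseFam k (lowerFam l f) n + raiseFam k (raiseFam l f) n)) := by
    simp only [raiseFam, genFam, lowerFam, smul_add, Finset.smul_sum,
      smul_comm ((Real.sqrt (n k + 1) : ℝ) : ℂ)]
  have h2 : ∑ l, (E.g l : ℂ) • (raiseFam k (lowerFam l f) n + raiseFam k (raiseFam l f) n) =
      ∑ l, (E.g l : ℂ) • (lowerFam l (raiseFam k f) n + raiseFam l (raiseFam k f) n) +
        (E.g k : ℂ) • f n := by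
    simp only [raiseFam_lowerFam, raiseFam_raiseFam k, smul_add, smul_ite, smul_zero,
      Finset.sum_add_distrib, Finset.sum_ite_eq', Finset.mem_univ, if_true]
    abel
  rw [h1, h2, genFam, energy_raise]
  have := hbar_ne_zero E
  push_cast
  match_scalars <;> field_simp

/-- This is `[H, b_k] = -ħ ω_k b_k - a g_k` multiplied by `i / ħ`. -/
theorem lowerFam_genFam (E : Bath N) (a : ℝ) (k : Fin N) (f : Occ N → V) (n : Occ N) :
    lowerFam k (genFam E a f) n = genFam E a (lowerFam k f) n -
      (Complex.I * E.omega k) • lowerFam k f n - (Complex.I * a * E.g k / E.hbar) • f n := by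
  have h1 : lowerFam k (genFam E a f) n = (Complex.I / (E.hbar : ℂ)) •
      (((energy E (lower k n) : ℝ) : ℂ) • lowerFam k f n + (a : ℂ) • ∑ l, (E.g l : ℂ) •
        (lowerFam k (lowerFam l f) n + lowerFam k (raiseFam l f) n)) := by
    simp only [raiseFam, genFam, lowerFam, smul_add, Finset.smul_sum,
      smul_comm ((Real.sqrt (n k) : ℝ) : ℂ)]
  have h2 : ∑ l, (E.g l : ℂ) • (lowerFam k (lowerFam l f) n + lowerFam k (raiseFam l f) n) =
      ∑ l, (E.g l : ℂ) • (lowerFam l (lowerFam k f) n + raiseFam l (lowerFam k f) n) -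
        (E.g k : ℂ) • f n := by
    simp only [raiseFam_lowerFam, lowerFam_lowerFam k, smul_add, smul_ite, smul_zero,
      Finset.sum_add_distrib, Finset.sum_ite_eq, Finset.mem_univ, if_true]
    abel
  have h3 : ((energy E (lower k n) : ℝ) : ℂ) • lowerFam k f n =
      ((energy E n : ℂ) - E.hbar * E.omega k) • lowerFam k f n := by
    -- At `n k = 0` truncated subtraction leaves the energy unchanged, but the prefactor `√(n k)`
    -- vanishes.
    by_cases h0 : n k = 0
    · simp [lowerFam, h0]
    · have := energy_raise E k (lower k n)
      rw [raise_lower h0] at this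
      rw [this]; push_cast; congr 1; ring
  rw [h1, h2, h3, genFam]
  have := hbar_ne_zero E
  match_scalars <;> field_simp

end Ladder

/-! ## Growth of the hierarchy -/

/-- A bound for the rate of growth of `genFam E a`. -/
noncomputable def growth (E : Bath N) (a : ℝ) : ℝ :=
  (1 / E.hbar) * (∑ k, E.hbar * E.omega k + |a| * ∑ l, 3 * |E.g l|)

theorem growth_nonneg (E : Bath N) (a : ℝ) : 0 ≤ growth E a := by
  have h1 := E.hbar_pos
  have h2 : 0 ≤ ∑ k, E.hbar * E.omega k :=
    Finset.sum_nonneg fun k _ => mul_nonneg h1.le (E.omega_pos k).le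
  rw [growth]; positivity

theorem norm_lowerFam_le {G : Type*} [NormedAddCommGroup G] [NormedSpace ℂ G] (k : Fin N)
    (f : Occ N → G) (n : Occ N) {B : ℝ} (hf : ‖f (lower k n)‖ ≤ B) :
    ‖lowerFam k f n‖ ≤ (excitations n + 1) * B := by
  have h1 : Real.sqrt (n k) ≤ excitations n + 1 := by
    have : (n k : ℝ) ≤ excitations n := by exact_mod_cast le_excitations k n
    rw [Real.sqrt_le_left (by positivity)]
    have : (0 : ℝ) ≤ n k := by positivity
    nlinarith
  rw [lowerFam, norm_smul, Complex.norm_real, Real.norm_of_nonneg (Real.sqrt_nonneg _)]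
  have := norm_nonneg (f (lower k n))
  gcongr

theorem norm_raiseFam_le {G : Type*} [NormedAddCommGroup G] [NormedSpace ℂ G] (k : Fin N)
    (f : Occ N → G) (n : Occ N) {B : ℝ} (hf : ‖f (raise k n)‖ ≤ B) :
    ‖raiseFam k f n‖ ≤ (excitations n + 1) * B := by
  have h1 : Real.sqrt (n k + 1) ≤ excitations n + 1 := by
    have : (n k : ℝ) ≤ excitations n := by exact_mod_cast le_excitations k n
    rw [Real.sqrt_le_left (by positivity)]
    have : (0 : ℝ) ≤ n k := by positivity
    nlinarith
  rw [raiseFam, norm_smul, Complex.norm_real, Real.norm_of_nonneg (Real.sqrt_nonneg _)]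
  have := norm_nonneg (f (raise k n))
  gcongr

theorem energy_nonneg (E : Bath N) (n : Occ N) : 0 ≤ energy E n :=
  Finset.sum_nonneg fun k _ => by
    have := E.hbar_pos; have := E.omega_pos k; positivity

theorem energy_le (E : Bath N) (n : Occ N) :
    energy E n ≤ (excitations n + 1) * ∑ k, E.hbar * E.omega k := by
  rw [energy, Finset.mul_sum]
  refine Finset.sum_le_sum fun k _ => ?_
  rw [mul_comm]
  have h1 := mul_pos E.hbar_pos (E.omega_pos k)
  have : (n k : ℝ) ≤ excitations n := by exact_mod_cast le_excitations k n
  gcongr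
  norm_num

theorem norm_genFam_le {G : Type*} [NormedAddCommGroup G] [NormedSpace ℂ G] (E : Bath N) (a : ℝ)
    (f : Occ N → G) (n : Occ N) {B : ℝ}
    (hf : ∀ m, excitations m ≤ excitations n + 1 → ‖f m‖ ≤ B) :
    ‖genFam E a f n‖ ≤ growth E a * (excitations n + 1) * B := by
  have hB : 0 ≤ B := (norm_nonneg _).trans (hf n (by omega))
  have hh := E.hbar_pos
  have hI : ‖Complex.I / (E.hbar : ℂ)‖ = 1 / E.hbar := by
    rw [norm_div, Complex.norm_I, Complex.norm_real, Real.norm_of_nonneg hh.le]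
  have h1 : ‖(energy E n : ℂ) • f n‖ ≤
      (excitations n + 1) * (∑ k, E.hbar * E.omega k) * B := by
    rw [norm_smul, Complex.norm_real, Real.norm_of_nonneg (energy_nonneg E n)]
    have h2 := energy_le E n
    have h3 := energy_nonneg E n
    have h4 := hf n (by omega)
    gcongr
    exact h3.trans h2
  have h2 : ‖∑ l, (E.g l : ℂ) • (lowerFam l f n + raiseFam l f n)‖ ≤
      ∑ l, 3 * |E.g l| * ((excitations n + 1) * B) := by
    refine (norm_sum_le _ _).trans (Finset.sum_le_sum fun l _ => ?_)
    rw [norm_smul, Complex.norm_real, Real.norm_eq_abs]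
    have h3 := norm_lowerFam_le l f n (hf _ ((excitations_lower_le l n).trans (by omega)))
    have h4 := norm_raiseFam_le l f n (hf _ (excitations_raise l n).le)
    have h5 := norm_add_le (lowerFam l f n) (raiseFam l f n)
    have h6 : 0 ≤ (excitations n + 1) * B := by positivity
    have h7 : ‖lowerFam l f n + raiseFam l f n‖ ≤ 3 * ((excitations n + 1) * B) := by linarith
    calc |E.g l| * ‖lowerFam l f n + raiseFam l f n‖
        ≤ |E.g l| * (3 * ((excitations n + 1) * B)) := by gcongr
      _ = _ := by ring
  rw [genFam, norm_smul, hI]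
  calc 1 / E.hbar * ‖(energy E n : ℂ) • f n +
        (a : ℂ) • ∑ l, (E.g l : ℂ) • (lowerFam l f n + raiseFam l f n)‖
      ≤ 1 / E.hbar * ((excitations n + 1) * (∑ k, E.hbar * E.omega k) * B +
          |a| * ∑ l, 3 * |E.g l| * ((excitations n + 1) * B)) := by
        gcongr
        refine (norm_add_le _ _).trans (add_le_add h1 ?_)
        rw [norm_smul, Complex.norm_real, Real.norm_eq_abs]
        gcongr
    _ = _ := by rw [← Finset.sum_mul, growth]; ring

/-- A family that solves the Schrödinger equation on the number states and vanishes at time `0`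
vanishes identically. -/
theorem eq_zero_of_schroedinger {G : Type*} [NormedAddCommGroup G] [NormedSpace ℂ G] (E : Bath N)
    (a : ℝ) {F : Occ N → ℝ → G} {C : ℝ}
    (hF : ∀ n t, HasDerivAt (F n) (-genFam E a (fun m => F m t) n) t)
    (hb : ∀ n t, ‖F n t‖ ≤ C) (h0 : ∀ n, F n 0 = 0) (n : Occ N) (t : ℝ) : F n t = 0 := by
  have hC : 0 ≤ C := (norm_nonneg _).trans (hb n t)
  -- A single constant has to dominate both the growth rate and the uniform bound; the `1` makes it
  -- positive.
  refine eq_zero_of_hierarchy (deg := excitations) (C := growth E a + C + 1)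
    (by linarith [growth_nonneg E a]) hF (fun n t B h => ?_) (fun n t => ?_) h0 n t
  · rw [norm_neg]
    have hB : 0 ≤ B := (norm_nonneg _).trans (h n (by omega))
    refine (norm_genFam_le E a _ n h).trans ?_
    gcongr
    linarith
  · refine (hb n t).trans ?_
    have := growth_nonneg E a
    have h1 : (0 : ℝ) ≤ excitations n := by positivity
    nlinarith [mul_nonneg (by linarith : 0 ≤ growth E a + C + 1) h1]

/-! ## Overlaps of two branches of the bath -/

/-- The overlaps `S n m t = ⟨X_b(t) n, X_a(t) m⟩` of number states that have evolved under the bath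
Hamiltonians displaced by `b` and by `a`. -/
structure IsOverlap (E : Bath N) (b a : ℝ) (S : Occ N → Occ N → ℝ → ℂ) : Prop where
  zero : ∀ n m, S n m 0 = if n = m then 1 else 0
  norm_le : ∀ n m t, ‖S n m t‖ ≤ 1
  hasDerivAt : ∀ n m t, HasDerivAt (S n m)
    (genFam E b (fun n => S n m t) n - genFam E a (fun m => S n m t) m) t

/-- The displacement of the mode `k` between the two branches. -/
noncomputable def displacement (E : Bath N) (b a : ℝ) (k : Fin N) (t : ℝ) : ℂ :=
  ((a - b) * E.g k / (E.hbar * E.omega k) : ℝ) *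
    (1 - Complex.exp (Complex.I * (E.omega k * t : ℝ)))

theorem hasDerivAt_exp_I (w t : ℝ) : HasDerivAt (fun t : ℝ => Complex.exp (Complex.I * (w * t : ℝ)))
    (Complex.I * w * Complex.exp (Complex.I * (w * t : ℝ))) t := by
  have h : HasDerivAt (fun t : ℝ => Complex.I * ((w * t : ℝ) : ℂ)) (Complex.I * w) t := by
    have := (((hasDerivAt_id t).const_mul w).ofReal_comp).const_mul Complex.I
    simpa using this
  simpa [mul_comm] using h.cexp

theorem norm_exp_I (x : ℝ) : ‖Complex.exp (Complex.I * (x : ℝ))‖ = 1 := by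
  rw [mul_comm]; exact Complex.norm_exp_ofReal_mul_I x

/-- In each branch the conjugated operator `X b_k X†` is `e^{iω_k t} b_k` plus a scalar proportional
to the displacement of that branch, so the two branches differ by a scalar. The proof avoids
operator identities: the defect `D` of the claimed relation solves a linear hierarchy and vanishes
at time `0`. -/
theorem IsOverlap.raise_left {E : Bath N} {b a : ℝ} {S : Occ N → Occ N → ℝ → ℂ}
    (hS : IsOverlap E b a S) (k : Fin N) (n m : Occ N) (t : ℝ) :
    raiseFam k (fun n => S n m t) n =
      lowerFam k (fun m => S n m t) m + displacement E b a k t * S n m t := by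
  set κ : ℝ := (a - b) * E.g k / (E.hbar * E.omega k) with hκ
  let D : Occ N × Occ N → ℝ → ℂ := fun x t => raiseFam k (fun n => S n x.2 t) x.1 -
    lowerFam k (fun m => S x.1 m t) x.2 - displacement E b a k t * S x.1 x.2 t
  -- The commutators leave an extra term `i ω_k D` in the derivative of `D`; this phase removes it,
  -- so that `F` solves the same equation as the overlaps.
  let F : Occ N × Occ N → ℝ → ℂ := fun x t =>
    Complex.exp (Complex.I * (-E.omega k * t : ℝ)) * D x t
  have hd : ∀ t, HasDerivAt (displacement E b a k)
      (-(κ * (Complex.I * E.omega k * Complex.exp (Complex.I * (E.omega k * t : ℝ))))) t := by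
    intro t
    exact (((hasDerivAt_exp_I (E.omega k) t).const_sub 1).const_mul (κ : ℂ)).congr_deriv (by ring)
  have hdn : ∀ t, ‖displacement E b a k t‖ ≤ 2 * |κ| := by
    intro t
    rw [displacement, norm_mul, Complex.norm_real, Real.norm_eq_abs, ← hκ, mul_comm]
    have := norm_sub_le (1 : ℂ) (Complex.exp (Complex.I * (E.omega k * t : ℝ)))
    rw [norm_exp_I, norm_one] at this
    gcongr; linarith
  have hF : ∀ x t, HasDerivAt (F x)
      (genFam E b (fun n => F (n, x.2) t) x.1 - genFam E a (fun m => F (x.1, m) t) x.2) t := by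
    rintro ⟨n, m⟩ t
    have h1 := (hS.hasDerivAt (raise k n) m t).const_smul ((Real.sqrt (n k + 1) : ℝ) : ℂ)
    have h2 := (hS.hasDerivAt n (lower k m) t).const_smul ((Real.sqrt (m k) : ℝ) : ℂ)
    have h3 := (hasDerivAt_exp_I (-E.omega k) t).mul
      ((h1.sub h2).sub ((hd t).mul (hS.hasDerivAt n m t)))
    refine h3.congr_deriv ?_
    have e1 := raiseFam_genFam E b k (fun n => S n m t) n
    have e2 := lowerFam_genFam E a k (fun m => S n m t) m
    have e3 : genFam E a (fun m => raiseFam k (fun n => S n m t) n) m =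
        ((Real.sqrt (n k + 1) : ℝ) : ℂ) • genFam E a (fun m => S (raise k n) m t) m :=
      genFam_smul E a _ _ m
    have e4 : genFam E b (fun n => lowerFam k (fun m => S n m t) m) n =
        ((Real.sqrt (m k) : ℝ) : ℂ) • genFam E b (fun n => S n (lower k m) t) n :=
      genFam_smul E b _ _ n
    have e5 : genFam E b (fun n => F (n, m) t) n =
        Complex.exp (Complex.I * (-E.omega k * t : ℝ)) *
          (genFam E b (raiseFam k (fun n => S n m t)) n -
            genFam E b (fun n => lowerFam k (fun m => S n m t) m) n -
            displacement E b a k t * genFam E b (fun n => S n m t) n) := by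
      have := genFam_smul E b (displacement E b a k t) (fun n => S n m t) n
      simp only [smul_eq_mul] at this
      rw [← this, ← genFam_sub, ← genFam_sub, ← smul_eq_mul, ← genFam_smul]
      rfl
    have e6 : genFam E a (fun m => F (n, m) t) m =
        Complex.exp (Complex.I * (-E.omega k * t : ℝ)) *
          (genFam E a (fun m => raiseFam k (fun n => S n m t) n) m -
            genFam E a (lowerFam k (fun m => S n m t)) m -
            displacement E b a k t * genFam E a (fun m => S n m t) m) := by
      have := genFam_smul E a (displacement E b a k t) (fun m => S n m t) m
      simp only [smul_eq_mul] at this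
      rw [← this, ← genFam_sub, ← genFam_sub, ← smul_eq_mul, ← genFam_smul]
      rfl
    -- The scalar terms of the two commutators differ by this amount; it fixes the amplitude of
    -- `displacement`.
    have e7 : (κ : ℂ) * E.omega k = (a - b) * E.g k / E.hbar := by
      have := hbar_ne_zero E
      have := omega_ne_zero E k
      rw [hκ]; push_cast; field_simp
    have e8 : displacement E b a k t =
        κ * (1 - Complex.exp (Complex.I * (E.omega k * t : ℝ))) := rfl
    rw [e5, e6, e3, e4]
    simp only [raiseFam, lowerFam, smul_eq_mul] at e1 e2 ⊢
    simp only [Pi.sub_apply, Pi.smul_apply, Pi.mul_apply, smul_eq_mul, mul_sub] at e1 e2 ⊢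
    rw [e1, e2, e8]
    push_cast
    linear_combination (Complex.I * Complex.exp (Complex.I * (-E.omega k * t)) * S n m t) * e7
  have hz := eq_zero_of_hierarchy (deg := fun x => excitations x.1 + excitations x.2)
    (C := growth E b + growth E a + 2 * |κ| + 2)
    (by linarith [growth_nonneg E b, growth_nonneg E a, abs_nonneg κ]) hF
    (by
      rintro ⟨n, m⟩ t B h
      have hB : 0 ≤ B := (norm_nonneg _).trans (h (n, m) (by omega))
      have h1 := norm_genFam_le E b (fun n => F (n, m) t) n (B := B)
        fun y hy => h (y, m) (by simp only; omega)
      have h2 := norm_genFam_le E a (fun m => F (n, m) t) m (B := B)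
        fun y hy => h (n, y) (by simp only; omega)
      have := growth_nonneg E b
      have := growth_nonneg E a
      refine (norm_sub_le _ _).trans ((add_le_add h1 h2).trans ?_)
      push_cast
      rw [← add_mul]
      gcongr
      nlinarith [abs_nonneg κ, mul_nonneg (growth_nonneg E b) (Nat.cast_nonneg (α := ℝ) (excitations m)),
        mul_nonneg (growth_nonneg E a) (Nat.cast_nonneg (α := ℝ) (excitations n)),
        mul_nonneg (abs_nonneg κ) (Nat.cast_nonneg (α := ℝ) (excitations n)),
        mul_nonneg (abs_nonneg κ) (Nat.cast_nonneg (α := ℝ) (excitations m)),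
        Nat.cast_nonneg (α := ℝ) (excitations n), Nat.cast_nonneg (α := ℝ) (excitations m)])
    (by
      rintro ⟨n, m⟩ t
      have h1 := norm_raiseFam_le k (fun n => S n m t) n (hS.norm_le _ _ _)
      have h2 := norm_lowerFam_le k (fun m => S n m t) m (hS.norm_le _ _ _)
      have h3 : ‖displacement E b a k t * S n m t‖ ≤ 2 * |κ| := by
        rw [norm_mul]
        exact (mul_le_of_le_one_right (norm_nonneg _) (hS.norm_le _ _ _)).trans (hdn t)
      have h4 : ‖D (n, m) t‖ ≤ (excitations n + 1) * 1 + (excitations m + 1) * 1 + 2 * |κ| :=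
        (norm_sub_le _ _).trans (add_le_add ((norm_sub_le _ _).trans (add_le_add h1 h2)) h3)
      rw [norm_mul, norm_exp_I, one_mul]
      refine h4.trans ?_
      have := growth_nonneg E b
      have := growth_nonneg E a
      push_cast
      nlinarith [abs_nonneg κ, mul_nonneg (abs_nonneg κ) (Nat.cast_nonneg (α := ℝ) (excitations n)),
        mul_nonneg (abs_nonneg κ) (Nat.cast_nonneg (α := ℝ) (excitations m)),
        mul_nonneg (growth_nonneg E b) (Nat.cast_nonneg (α := ℝ) (excitations m)),
        mul_nonneg (growth_nonneg E b) (Nat.cast_nonneg (α := ℝ) (excitations n)),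
        mul_nonneg (growth_nonneg E a) (Nat.cast_nonneg (α := ℝ) (excitations n)),
        mul_nonneg (growth_nonneg E a) (Nat.cast_nonneg (α := ℝ) (excitations m)),
        Nat.cast_nonneg (α := ℝ) (excitations n), Nat.cast_nonneg (α := ℝ) (excitations m)])
    (by
      rintro ⟨n, m⟩
      have h1 : raiseFam k (fun n => S n m 0) n = lowerFam k (fun m => S n m 0) m := by
        simp only [raiseFam, lowerFam, hS.zero]
        -- Here `lower k m = m` by truncation, so the right-hand side is killed by `√0`, while the
        -- left vanishes because `raise k n` is occupied in the mode `k`.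
        by_cases h0 : m k = 0
        · rw [if_neg, h0]
          · simp
          · intro h
            have := raise_self k n
            rw [h] at this; omega
        · by_cases h : raise k n = m
          · subst h
            simp [lower_raise, raise_self]
          · rw [if_neg h, if_neg]
            · simp
            · rintro rfl
              exact h (raise_lower h0)
      simp [F, D, h1, displacement])
    (n, m) t
  have h2 : D (n, m) t = 0 := (mul_eq_zero.1 hz).resolve_left (Complex.exp_ne_zero _)
  linear_combination h2

end IncoherentControl

namespace IncoherentControl

variable {N : ℕ}

/-! ### Exchange of branches and the differential equation of the thermal overlap. -/

theorem conj_genFam (E : Bath N) (a : ℝ) (f : Occ N → ℂ) (n : Occ N) :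
    star (genFam E a f n) = -genFam E a (fun n => star (f n)) n := by
  simp only [genFam, lowerFam, raiseFam, smul_eq_mul, star_mul', star_add, star_sum,
    RCLike.star_def, Complex.conj_ofReal, map_div₀, Complex.conj_I]
  ring

theorem IsOverlap.symm {E : Bath N} {b a : ℝ} {S : Occ N → Occ N → ℝ → ℂ}
    (hS : IsOverlap E b a S) : IsOverlap E a b fun n m t => star (S m n t) where
  zero n m := by
    rw [hS.zero]; simp only [eq_comm (a := n)]
    split_ifs <;> simp
  norm_le n m t := by rw [norm_star]; exact hS.norm_le m n t
  hasDerivAt n m t := by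
    refine (hS.hasDerivAt m n t).star.congr_deriv ?_
    rw [star_sub, conj_genFam, conj_genFam]; ring

theorem displacement_eq (E : Bath N) (b a : ℝ) (k : Fin N) (t : ℝ) :
    displacement E b a k t = (a - b) * E.g k / (E.hbar * E.omega k) *
      (1 - (Real.cos (E.omega k * t) : ℝ) - Complex.I * (Real.sin (E.omega k * t) : ℝ)) := by
  rw [displacement, mul_comm Complex.I, Complex.exp_mul_I]
  push_cast
  ring

/-- The complex conjugate of `IsOverlap.raise_left` for the exchanged branches, under which the
displacement changes sign. -/
theorem IsOverlap.lower_left {E : Bath N} {b a : ℝ} {S : Occ N → Occ N → ℝ → ℂ}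
    (hS : IsOverlap E b a S) (k : Fin N) (n m : Occ N) (t : ℝ) :
    lowerFam k (fun n => S n m t) n =
      raiseFam k (fun m => S n m t) m + star (displacement E b a k t) * S n m t := by
  have h := congrArg star (hS.symm.raise_left k m n t)
  have h1 : star (displacement E b a k t) = -star (displacement E a b k t) := by
    simp only [displacement_eq, star_mul', star_sub, star_div₀, RCLike.star_def,
      Complex.conj_ofReal, Complex.conj_I, map_one]
    ring
  simp only [raiseFam, lowerFam, smul_eq_mul, star_mul', star_add, RCLike.star_def,
    Complex.conj_ofReal, Complex.conj_conj] at h h1 ⊢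
  rw [h, h1]
  ring

/-- The thermal average of the overlap of two branches. -/
noncomputable def thermalOverlap (E : Bath N) (S : Occ N → Occ N → ℝ → ℂ) (t : ℝ) : ℂ :=
  ∑' n, (thermalWeight E n : ℂ) * S n n t

theorem summable_thermalWeight_mul_of_le (E : Bath N) {f : Occ N → ℂ}
    (hf : ∀ n, ‖f n‖ ≤ excitations n + 1) : Summable fun n => (thermalWeight E n : ℂ) * f n := by
  refine Summable.of_norm_bounded (summable_thermalWeight_mul E) fun n => ?_
  rw [norm_mul, Complex.norm_real, Real.norm_of_nonneg (thermalWeight_pos E n).le]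
  exact mul_le_mul_of_nonneg_left (hf n) (thermalWeight_pos E n).le

theorem summable_thermalWeight_mul_of_le_one (E : Bath N) {f : Occ N → ℂ}
    (hf : ∀ n, ‖f n‖ ≤ 1) : Summable fun n => (thermalWeight E n : ℂ) * f n :=
  summable_thermalWeight_mul_of_le E fun n => (hf n).trans (by
    have : (0 : ℝ) ≤ excitations n := by positivity
    linarith)

/-- The exponent of `gam`. -/
noncomputable def gamExponent (E : Bath N) (b a : ℝ) (t : ℝ) : ℂ :=
  ((-(a - b) ^ 2 * decay E t : ℝ) : ℂ) + Complex.I * (((a ^ 2 - b ^ 2) * phase E t : ℝ) : ℂ)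

/-- The derivative of the exponent of `gam`. -/
noncomputable def gamExponentDeriv (E : Bath N) (b a : ℝ) (t : ℝ) : ℂ :=
  ∑ k, (E.g k / (E.hbar * E.omega k) : ℂ) ^ 2 * E.omega k *
    (-(a - b) ^ 2 * (1 + 2 * meanOccupation E k) * (Real.sin (E.omega k * t) : ℝ) +
      Complex.I * (a ^ 2 - b ^ 2) * (1 - (Real.cos (E.omega k * t) : ℝ)))

theorem hasDerivAt_gamExponent (E : Bath N) (b a t : ℝ) :
    HasDerivAt (gamExponent E b a) (gamExponentDeriv E b a t) t := by
  have h0 : ∀ k, HasDerivAt (fun t : ℝ => E.omega k * t) (E.omega k) t := fun k => by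
    simpa using (hasDerivAt_id t).const_mul (E.omega k)
  have h1 : HasDerivAt (decay E) (∑ k, (E.g k / (E.hbar * E.omega k)) ^ 2 *
      (1 + 2 * meanOccupation E k) * (Real.sin (E.omega k * t) * E.omega k)) t := by
    refine HasDerivAt.fun_sum fun k _ => HasDerivAt.const_mul _ ?_
    simpa using ((h0 k).cos.const_sub 1)
  have h2 : HasDerivAt (phase E) (∑ k, (E.g k / (E.hbar * E.omega k)) ^ 2 *
      (E.omega k - Real.cos (E.omega k * t) * E.omega k)) t :=
    HasDerivAt.fun_sum fun k _ => HasDerivAt.const_mul _ ((h0 k).sub (h0 k).sin)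
  refine ((h1.const_mul (-(a - b) ^ 2)).ofReal_comp.add
    (((h2.const_mul (a ^ 2 - b ^ 2)).ofReal_comp).const_mul Complex.I)).congr_deriv ?_
  rw [gamExponentDeriv, Finset.mul_sum, Finset.mul_sum, Complex.ofReal_sum, Complex.ofReal_sum,
    Finset.mul_sum, ← Finset.sum_add_distrib]
  refine Finset.sum_congr rfl fun k _ => ?_
  push_cast
  ring

/-- For each mode the derivative involves four thermal sums: a ladder operator, lowering or raising,
in either branch. Two displacement relations and two shifts of the thermal weights express all four
as multiples of the overlap itself. -/
theorem IsOverlap.hasDerivAt_thermalOverlap {E : Bath N} {b a : ℝ} {S : Occ N → Occ N → ℝ → ℂ}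
    (hS : IsOverlap E b a S) (t : ℝ) :
    HasDerivAt (thermalOverlap E S) (gamExponentDeriv E b a t * thermalOverlap E S t) t := by
  have hd : HasDerivAt (thermalOverlap E S) (∑' n, (thermalWeight E n : ℂ) *
      (genFam E b (fun m => S m n t) n - genFam E a (fun m => S n m t) n)) t := by
    refine hasDerivAt_tsum (u := fun n => (growth E b + growth E a) *
        (thermalWeight E n * (excitations n + 1))) (g := fun n t => (thermalWeight E n : ℂ) * S n n t)
      ((summable_thermalWeight_mul E).mul_left _)
      (fun n t => (hS.hasDerivAt n n t).const_mul _) (fun n t => ?_) (y₀ := 0) ?_ t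
    · rw [norm_mul, Complex.norm_real, Real.norm_of_nonneg (thermalWeight_pos E n).le]
      have h1 := norm_genFam_le E b (fun m => S m n t) n (B := 1) fun m _ => hS.norm_le _ _ _
      have h2 := norm_genFam_le E a (fun m => S n m t) n (B := 1) fun m _ => hS.norm_le _ _ _
      have h3 := norm_sub_le (genFam E b (fun m => S m n t) n) (genFam E a (fun m => S n m t) n)
      calc _ ≤ thermalWeight E n * ((growth E b + growth E a) * (excitations n + 1)) :=
            mul_le_mul_of_nonneg_left (by linarith) (thermalWeight_pos E n).le
        _ = _ := by ring
    · exact summable_thermalWeight_mul_of_le_one E fun n => hS.norm_le _ _ _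
  refine hd.congr_deriv ?_
  set Γ := thermalOverlap E S t with hΓ
  have sΓ : Summable fun n => (thermalWeight E n : ℂ) * S n n t :=
    summable_thermalWeight_mul_of_le_one E fun n => hS.norm_le _ _ _
  have sL1 : ∀ k, Summable fun n => (thermalWeight E n : ℂ) * lowerFam k (fun m => S m n t) n :=
    fun k => summable_thermalWeight_mul_of_le E fun n => by
      simpa using norm_lowerFam_le k (fun m => S m n t) n (hS.norm_le _ _ _)
  have sR1 : ∀ k, Summable fun n => (thermalWeight E n : ℂ) * raiseFam k (fun m => S m n t) n :=
    fun k => summable_thermalWeight_mul_of_le E fun n => by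
      simpa using norm_raiseFam_le k (fun m => S m n t) n (hS.norm_le _ _ _)
  have sL2 : ∀ k, Summable fun n => (thermalWeight E n : ℂ) * lowerFam k (fun m => S n m t) n :=
    fun k => summable_thermalWeight_mul_of_le E fun n => by
      simpa using norm_lowerFam_le k (fun m => S n m t) n (hS.norm_le _ _ _)
  have sR2 : ∀ k, Summable fun n => (thermalWeight E n : ℂ) * raiseFam k (fun m => S n m t) n :=
    fun k => summable_thermalWeight_mul_of_le E fun n => by
      simpa using norm_raiseFam_le k (fun m => S n m t) n (hS.norm_le _ _ _)
  -- On the diagonal the energy terms of the two generators cancel; only the coupling survives.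
  have hsum : HasSum (fun n => (thermalWeight E n : ℂ) *
      (genFam E b (fun m => S m n t) n - genFam E a (fun m => S n m t) n))
      (∑ k, Complex.I / E.hbar * E.g k *
        (b * (∑' n, (thermalWeight E n : ℂ) * lowerFam k (fun m => S m n t) n +
          ∑' n, (thermalWeight E n : ℂ) * raiseFam k (fun m => S m n t) n) -
        a * (∑' n, (thermalWeight E n : ℂ) * lowerFam k (fun m => S n m t) n +
          ∑' n, (thermalWeight E n : ℂ) * raiseFam k (fun m => S n m t) n))) := by
    refine (hasSum_sum fun k (_ : k ∈ Finset.univ) =>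
      ((((sL1 k).hasSum.add (sR1 k).hasSum).mul_left (b : ℂ)).sub
        (((sL2 k).hasSum.add (sR2 k).hasSum).mul_left (a : ℂ))).mul_left
          (Complex.I / E.hbar * E.g k)).congr_fun fun n => ?_
    simp only [genFam, smul_eq_mul, Finset.mul_sum, mul_add, mul_sub, Finset.sum_add_distrib,
      Finset.sum_sub_distrib]
    ring_nf
  rw [hsum.tsum_eq, gamExponentDeriv, Finset.sum_mul]
  refine Finset.sum_congr rfl fun k _ => ?_
  have hR1 : ∑' n, (thermalWeight E n : ℂ) * raiseFam k (fun m => S m n t) n =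
      ∑' n, (thermalWeight E n : ℂ) * lowerFam k (fun m => S n m t) n +
        displacement E b a k t * Γ := by
    rw [hΓ, thermalOverlap, ← tsum_mul_left, ← (sL2 k).tsum_add (sΓ.mul_left _)]
    refine tsum_congr fun n => ?_
    rw [hS.raise_left]; ring
  have hL1 : ∑' n, (thermalWeight E n : ℂ) * lowerFam k (fun m => S m n t) n =
      ∑' n, (thermalWeight E n : ℂ) * raiseFam k (fun m => S n m t) n +
        star (displacement E b a k t) * Γ := by
    rw [hΓ, thermalOverlap, ← tsum_mul_left, ← (sR2 k).tsum_add (sΓ.mul_left _)]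
    refine tsum_congr fun n => ?_
    rw [hS.lower_left]; ring
  -- Shifting `n` to `raise k n` turns lowering in the right branch into raising in the left one, at
  -- the price of a Boltzmann factor.
  have hL2 : ∑' n, (thermalWeight E n : ℂ) * lowerFam k (fun m => S n m t) n =
      boltzmann E k * ∑' n, (thermalWeight E n : ℂ) * raiseFam k (fun m => S m n t) n := by
    rw [tsum_eq_tsum_raise k (fun n h => by simp [lowerFam, h]), ← tsum_mul_left]
    refine tsum_congr fun n => ?_
    simp only [lowerFam, raiseFam, thermalWeight_raise, lower_raise, raise_self, smul_eq_mul]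
    push_cast; ring
  have hL1' : ∑' n, (thermalWeight E n : ℂ) * lowerFam k (fun m => S m n t) n =
      boltzmann E k * ∑' n, (thermalWeight E n : ℂ) * raiseFam k (fun m => S n m t) n := by
    rw [tsum_eq_tsum_raise k (fun n h => by simp [lowerFam, h]), ← tsum_mul_left]
    refine tsum_congr fun n => ?_
    simp only [lowerFam, raiseFam, thermalWeight_raise, lower_raise, raise_self, smul_eq_mul]
    push_cast; ring
  generalize ∑' n, (thermalWeight E n : ℂ) * raiseFam k (fun m => S m n t) n = R1 at *
  generalize ∑' n, (thermalWeight E n : ℂ) * raiseFam k (fun m => S n m t) n = R2 at *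
  generalize ∑' n, (thermalWeight E n : ℂ) * lowerFam k (fun m => S m n t) n = L1 at *
  generalize ∑' n, (thermalWeight E n : ℂ) * lowerFam k (fun m => S n m t) n = L2 at *
  have hq : (1 : ℂ) - boltzmann E k ≠ 0 := by
    have := boltzmann_lt_one E k
    rw [← Complex.ofReal_one, ← Complex.ofReal_sub]
    exact Complex.ofReal_ne_zero.2 (by linarith)
  -- Solving `R1 = L2 + d Γ`, `L2 = q R1`, where `q` is the Boltzmann factor and `d` the
  -- displacement; `1 / (1 - q) = 1 + n̄` brings in the mean occupation.
  have eR1 : R1 = displacement E b a k t * Γ / (1 - boltzmann E k) := by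
    rw [eq_div_iff hq]; linear_combination hR1 + hL2
  have eR2 : R2 = -(star (displacement E b a k t) * Γ / (1 - boltzmann E k)) := by
    rw [← neg_div, eq_div_iff hq]; linear_combination hL1' - hL1
  rw [hL1', hL2, eR1, eR2, meanOccupation_eq]
  simp only [displacement_eq, star_mul', star_sub, star_div₀, RCLike.star_def,
      Complex.conj_ofReal, Complex.conj_I, map_one]
  have := hbar_ne_zero E
  have := omega_ne_zero E k
  push_cast
  field_simp
  ring_nf
  simp only [Complex.I_sq]
  ring

theorem decay_zero (E : Bath N) : decay E 0 = 0 := by simp [decay]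

theorem phase_zero (E : Bath N) : phase E 0 = 0 := by simp [phase]

/-- The thermal average of the overlap of two branches is the decoherence factor. -/
theorem IsOverlap.thermalOverlap_eq {E : Bath N} {b a : ℝ} {S : Occ N → Occ N → ℝ → ℂ}
    (hS : IsOverlap E b a S) (t : ℝ) :
    thermalOverlap E S t = Complex.exp (gamExponent E b a t) := by
  have hd : ∀ t, HasDerivAt
      (fun t => thermalOverlap E S t * Complex.exp (-gamExponent E b a t)) 0 t := by
    intro t
    refine ((hS.hasDerivAt_thermalOverlap t).mul
      (hasDerivAt_gamExponent E b a t).neg.cexp).congr_deriv ?_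
    simp only [Pi.neg_apply]
    ring
  have h := is_const_of_deriv_eq_zero (fun t => (hd t).differentiableAt) (fun t => (hd t).deriv) t 0
  have h0 : thermalOverlap E S 0 = 1 := by
    simp only [thermalOverlap, hS.zero, if_true, mul_one]
    rw [← Complex.ofReal_tsum, tsum_thermalWeight, Complex.ofReal_one]
  have h1 : gamExponent E b a 0 = 0 := by simp [gamExponent, decay_zero, phase_zero]
  simp only [h0, h1, neg_zero, Complex.exp_zero, mul_one, Complex.exp_neg] at h
  exact (mul_inv_eq_one₀ (Complex.exp_ne_zero _)).1 h

end IncoherentControl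

namespace IncoherentControl

variable {N : ℕ}

/-! ## Slices of vectors of the total Hilbert space -/

/-- The Hilbert space of the bath. -/
abbrev BathSpace (N : ℕ) : Type := lp (fun _ : Occ N => ℂ) 2

theorem summable_norm_sq {ι : Type*} (ψ : lp (fun _ : ι => ℂ) 2) : Summable fun x => ‖ψ x‖ ^ 2 := by
  have := (lp.memℓp ψ).summable (by simp)
  simpa using this

theorem norm_sq_eq_tsum {ι : Type*} (ψ : lp (fun _ : ι => ℂ) 2) : ‖ψ‖ ^ 2 = ∑' x, ‖ψ x‖ ^ 2 := by
  have := lp.norm_rpow_eq_tsum (p := 2) (by simp) ψ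
  simpa using this

/-- The linear map underlying `slice`. -/
noncomputable def sliceLin (a : SP) : Total N →ₗ[ℂ] BathSpace N where
  toFun ψ := ⟨fun n => ψ (a, n), memℓp_gen (by
    have := (summable_norm_sq ψ).comp_injective (Prod.mk_right_injective (β := Occ N) a)
    simpa [Function.comp_def] using this)⟩
  map_add' ψ χ := by ext n; rfl
  map_smul' c ψ := by ext n; rfl

/-- The component `⟨a|ψ⟩` of a vector `ψ` of the total Hilbert space. -/
noncomputable def slice (a : SP) : Total N →L[ℂ] BathSpace N :=
  (sliceLin a).mkContinuous 1 fun ψ => by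
    refine le_of_sq_le_sq ?_ (by positivity) |>.trans_eq rfl
    rw [one_mul, norm_sq_eq_tsum, norm_sq_eq_tsum]
    exact tsum_comp_le_tsum_of_inj (summable_norm_sq ψ) (fun _ => by positivity)
      (Prod.mk_right_injective a)

theorem slice_apply (a : SP) (ψ : Total N) (n : Occ N) : slice a ψ n = ψ (a, n) := rfl

theorem sum_norm_sq_slice (ψ : Total N) : ∑ a, ‖slice a ψ‖ ^ 2 = ‖ψ‖ ^ 2 := by
  rw [norm_sq_eq_tsum ψ, (summable_norm_sq ψ).tsum_prod, tsum_fintype]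
  simp only [norm_sq_eq_tsum, slice_apply]

theorem inner_ket_left (x : SP × Occ N) (ψ : Total N) : inner ℂ (ket x) ψ = ψ x := by
  rw [ket, lp.inner_single_left]; simp

theorem inner_ket_right (x : SP × Occ N) (ψ : Total N) : inner ℂ ψ (ket x) = star (ψ x) := by
  rw [← inner_conj_symm, inner_ket_left]; rfl

theorem norm_ket (x : SP × Occ N) : ‖ket x‖ = 1 := by
  rw [ket, lp.norm_single (by norm_num)]; simp

theorem slice_ket (a b : SP) (n : Occ N) :
    slice a (ket (b, n)) = if a = b then lp.single 2 n (1 : ℂ) else 0 := by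
  ext m
  rw [slice_apply, ket, lp.single_apply]
  by_cases h : a = b
  · subst h
    simp [lp.single_apply, Pi.single_apply]
  · simp [h]

/-! ## Partial trace of an evolved state -/

theorem summable_initialState (E : Bath N) (ρ : Matrix SP SP ℂ) :
    Summable fun n : Occ N => (thermalWeight E n : ℂ) •
      ∑ a : SP, ∑ b : SP, ρ a b • InnerProductSpace.rankOne ℂ (ket (a, n)) (ket (b, n)) := by
  refine Summable.of_norm_bounded
    ((summable_thermalWeight E).mul_right (∑ a : SP, ∑ b : SP, ‖ρ a b‖)) fun n => ?_
  rw [norm_smul, Complex.norm_real, Real.norm_of_nonneg (thermalWeight_pos E n).le]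
  refine mul_le_mul_of_nonneg_left ?_ (thermalWeight_pos E n).le
  refine (norm_sum_le _ _).trans (Finset.sum_le_sum fun a _ => (norm_sum_le _ _).trans
    (Finset.sum_le_sum fun b _ => ?_))
  rw [norm_smul, InnerProductSpace.norm_rankOne, norm_ket, norm_ket, mul_one, mul_one]

/-- Absolute summability via `|x y| ≤ |x|² + |y|²`; it justifies interchanging the bath trace with
the thermal sum. -/
theorem summable_thermalWeight_mul_slice (E : Bath N) (x y : Occ N → BathSpace N)
    (hx : ∀ m, ‖x m‖ ≤ 1) (hy : ∀ m, ‖y m‖ ≤ 1) :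
    Summable fun p : Occ N × Occ N =>
      (thermalWeight E p.1 : ℂ) * (x p.1 p.2 * star (y p.1 p.2)) := by
  have hb : ∀ m n, ‖x m n * star (y m n)‖ ≤ ‖x m n‖ ^ 2 + ‖y m n‖ ^ 2 := fun m n => by
    rw [norm_mul, norm_star]; nlinarith [sq_nonneg (‖x m n‖ - ‖y m n‖),
      sq_nonneg ‖x m n‖, sq_nonneg ‖y m n‖]
  have hs : ∀ m, Summable fun n => ‖x m n‖ ^ 2 + ‖y m n‖ ^ 2 := fun m =>
    (summable_norm_sq (x m)).add (summable_norm_sq (y m))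
  have hs' : ∀ m, Summable fun n => ‖x m n * star (y m n)‖ := fun m =>
    (hs m).of_nonneg_of_le (fun _ => norm_nonneg _) (hb m)
  have hle : ∀ m, ∑' n, ‖x m n * star (y m n)‖ ≤ 2 := fun m => by
    refine ((hs' m).tsum_le_tsum (hb m) (hs m)).trans ?_
    rw [(summable_norm_sq (x m)).tsum_add (summable_norm_sq (y m)), ← norm_sq_eq_tsum,
      ← norm_sq_eq_tsum]
    have h1 := hx m
    have h2 := hy m
    have := norm_nonneg (x m)
    have := norm_nonneg (y m)
    nlinarith
  refine Summable.of_norm ?_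
  rw [summable_prod_of_nonneg fun _ => norm_nonneg _]
  have he : ∀ m n, ‖(thermalWeight E m : ℂ) * (x m n * star (y m n))‖ =
      thermalWeight E m * ‖x m n * star (y m n)‖ := fun m n => by
    rw [norm_mul, Complex.norm_real, Real.norm_of_nonneg (thermalWeight_pos E m).le]
  simp only [he]
  refine ⟨fun m => (hs' m).mul_left _, ?_⟩
  refine Summable.of_nonneg_of_le
    (fun m => tsum_nonneg fun n => mul_nonneg (thermalWeight_pos E m).le (norm_nonneg _))
    (fun m => ?_) ((summable_thermalWeight E).mul_right 2)
  rw [tsum_mul_left]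
  exact mul_le_mul_of_nonneg_left (hle m) (thermalWeight_pos E m).le

theorem norm_slice_le (a : SP) (ψ : Total N) : ‖slice a ψ‖ ≤ ‖ψ‖ := by
  refine le_of_sq_le_sq ?_ (norm_nonneg _)
  rw [← sum_norm_sq_slice ψ]
  exact Finset.single_le_sum (f := fun a => ‖slice a ψ‖ ^ 2) (fun _ _ => by positivity)
    (Finset.mem_univ a)

theorem summable_slice_mul (E : Bath N) {Y : Total N →L[ℂ] Total N} (hY : ∀ ψ, ‖Y ψ‖ ≤ ‖ψ‖)
    (a b c d : SP) : Summable fun p : Occ N × Occ N => (thermalWeight E p.1 : ℂ) *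
      (slice a (Y (ket (c, p.1))) p.2 * star (slice b (Y (ket (d, p.1))) p.2)) :=
  summable_thermalWeight_mul_slice E (fun m => slice a (Y (ket (c, m))))
    (fun m => slice b (Y (ket (d, m))))
    (fun _ => (norm_slice_le _ _).trans ((hY _).trans (norm_ket _).le))
    (fun _ => (norm_slice_le _ _).trans ((hY _).trans (norm_ket _).le))

theorem inner_ket_conj_rankOne (Y : Total N →L[ℂ] Total N) (x y z w : SP × Occ N) :
    inner ℂ (ket x) ((Y * InnerProductSpace.rankOne ℂ (ket z) (ket w) * star Y) (ket y)) =
      Y (ket z) x * star (Y (ket w) y) := by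
  rw [mul_assoc, mul_apply_eq_comp, mul_apply_eq_comp, InnerProductSpace.rankOne_apply,
    map_smul, ContinuousLinearMap.star_eq_adjoint, ContinuousLinearMap.adjoint_inner_right,
    inner_ket_right, inner_smul_right, inner_ket_left, mul_comm]

theorem hasSum_inner_conj_initialState (E : Bath N) (ρ : Matrix SP SP ℂ)
    (Y : Total N →L[ℂ] Total N) (x y : SP × Occ N) :
    HasSum (fun m => ∑ c, ∑ d, ρ c d * ((thermalWeight E m : ℂ) *
      (Y (ket (c, m)) x * star (Y (ket (d, m)) y))))
      (inner ℂ (ket x) ((Y * initialState E ρ * star Y) (ket y))) := by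
  have h1 := ((summable_initialState E ρ).hasSum.mul_left Y).mul_right (star Y)
  have h2 := h1.mapL ((innerSL ℂ (ket x)).comp (ContinuousLinearMap.apply ℂ (Total N) (ket y)))
  refine h2.congr_fun fun m => ?_
  simp only [mul_smul_comm, smul_mul_assoc, Finset.mul_sum, Finset.sum_mul, map_smul, map_sum,
    ContinuousLinearMap.comp_apply, ContinuousLinearMap.apply_apply, innerSL_apply_apply,
    inner_ket_conj_rankOne, smul_eq_mul]
  exact Finset.sum_congr rfl fun c _ => Finset.sum_congr rfl fun d _ => by ring

/-- After the interchange of sums, the trace over the final number states is an inner product of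
bath vectors. -/
theorem traceE_conj_initialState (E : Bath N) (ρ : Matrix SP SP ℂ) {Y : Total N →L[ℂ] Total N}
    (hY : ∀ ψ, ‖Y ψ‖ ≤ ‖ψ‖) (a b : SP) :
    traceE (Y * initialState E ρ * star Y) a b = ∑ c, ∑ d, ρ c d * ∑' m, (thermalWeight E m : ℂ) *
      inner ℂ (slice b (Y (ket (d, m)))) (slice a (Y (ket (c, m)))) := by
  have hg : ∀ c d, Summable fun p : Occ N × Occ N => (thermalWeight E p.2 : ℂ) *
      (slice a (Y (ket (c, p.2))) p.1 * star (slice b (Y (ket (d, p.2))) p.1)) := fun c d =>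
    (summable_slice_mul E hY a b c d).prod_symm
  have hn : ∀ n, inner ℂ (ket (a, n)) ((Y * initialState E ρ * star Y) (ket (b, n))) =
      ∑ c, ∑ d, ρ c d * ∑' m, (thermalWeight E m : ℂ) *
        (slice a (Y (ket (c, m))) n * star (slice b (Y (ket (d, m))) n)) := fun n =>
    (hasSum_inner_conj_initialState E ρ Y (a, n) (b, n)).unique
      (hasSum_sum fun c _ => hasSum_sum fun d _ => ((hg c d).prod_factor n).hasSum.mul_left _)
  have hn' := fun c d => ((hg c d).prod).hasSum.mul_left (ρ c d)
  rw [traceE, Matrix.of_apply]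
  simp only [hn]
  refine (hasSum_sum fun c _ => hasSum_sum fun d _ => hn' c d).tsum_eq.trans ?_
  refine Finset.sum_congr rfl fun c _ => Finset.sum_congr rfl fun d _ => ?_
  congr 1
  refine (Summable.tsum_comm (f := fun m n => (thermalWeight E m : ℂ) *
    (slice a (Y (ket (c, m))) n * star (slice b (Y (ket (d, m))) n)))
    (summable_slice_mul E hY a b c d)).trans ?_
  refine tsum_congr fun m => ?_
  rw [tsum_mul_left, lp.inner_eq_tsum]
  rfl

/-! ## The propagator -/

theorem IsPropagator.norm_apply {E : Bath N} {AT : Matrix SP SP ℂ}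
    {X : ℝ → Total N →L[ℂ] Total N} (hX : IsPropagator E AT X) (t : ℝ) (ψ : Total N) :
    ‖X t ψ‖ = ‖ψ‖ :=
  ContinuousLinearMap.norm_map_of_mem_unitary (hX.unitary t) ψ

theorem IsPropagator.zero {E : Bath N} {AT : Matrix SP SP ℂ}
    {X : ℝ → Total N →L[ℂ] Total N} (hX : IsPropagator E AT X) : X 0 = 1 := by
  have h1 := hX.add 0 0
  rw [add_zero] at h1
  have h2 := Unitary.star_mul_self_of_mem (hX.unitary 0)
  calc X 0 = star (X 0) * X 0 * X 0 := by rw [h2, one_mul]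
    _ = star (X 0) * (X 0 * X 0) := mul_assoc _ _ _
    _ = 1 := by rw [← h1, h2]

/-- From `X s = X t * X (s - t)` and the derivative at `0`. The Hamiltonian acts before `X t`, hence
only on the core. -/
theorem IsPropagator.hasDerivAt_apply {E : Bath N} {AT : Matrix SP SP ℂ}
    {X : ℝ → Total N →L[ℂ] Total N} (hX : IsPropagator E AT X) (ψ : Core N) (t : ℝ) :
    HasDerivAt (fun t => X t (embed N ψ))
      (X t ((-(Complex.I / (E.hbar : ℂ))) • embed N (hamiltonian E AT ψ))) t := by
  have h1 : HasDerivAt (fun s => X (s - t) (embed N ψ))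
      ((-(Complex.I / (E.hbar : ℂ))) • embed N (hamiltonian E AT ψ)) t := by
    have h0 : HasDerivAt (fun t => X t (embed N ψ))
      ((-(Complex.I / (E.hbar : ℂ))) • embed N (hamiltonian E AT ψ)) (t - t) := by
      rw [sub_self]; exact hX.hasDerivAt ψ
    exact h0.comp_sub_const t t
  have h2 := ((X t).restrictScalars ℝ).hasFDerivAt.comp_hasDerivAt t h1
  refine h2.congr_of_eventuallyEq (Filter.Eventually.of_forall fun s => ?_)
  have := hX.add t (s - t)
  rw [add_sub_cancel] at this
  simp only [this, Function.comp_def]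
  rfl

/-! ### The Hamiltonian on product vectors. -/

/-- The vector `w ⊗ |n⟩`. -/
noncomputable def coreVec (w : SP → ℂ) (n : Occ N) : Core N := ∑ a, Finsupp.single (a, n) (w a)

theorem annihilate_coreVec (k : Fin N) (w : SP → ℂ) (n : Occ N) :
    annihilate k (coreVec w n) = ((Real.sqrt (n k) : ℝ) : ℂ) • coreVec w (lower k n) := by
  simp only [annihilate, coreVec, map_sum, Finsupp.linearCombination_single, Finsupp.smul_single,
    Finset.smul_sum, smul_eq_mul, lower, mul_comm]

theorem create_coreVec (k : Fin N) (w : SP → ℂ) (n : Occ N) :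
    create k (coreVec w n) = ((Real.sqrt (n k + 1) : ℝ) : ℂ) • coreVec w (raise k n) := by
  simp only [create, coreVec, map_sum, Finsupp.linearCombination_single, Finsupp.smul_single,
    Finset.smul_sum, smul_eq_mul, raise, mul_comm]

theorem onSP_coreVec (A : Matrix SP SP ℂ) (w : SP → ℂ) (n : Occ N) :
    onSP A (coreVec w n) = coreVec (A.mulVec w) n := by
  simp only [onSP, coreVec, map_sum, Finsupp.linearCombination_single, Finset.smul_sum,
    Finsupp.smul_single, smul_eq_mul, Matrix.mulVec, dotProduct]
  rw [Finset.sum_comm]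
  refine Finset.sum_congr rfl fun a _ => ?_
  rw [Finsupp.single_finsetSum]
  exact Finset.sum_congr rfl fun b _ => by rw [mul_comm]

theorem coreVec_smul (c : ℂ) (w : SP → ℂ) (n : Occ N) :
    coreVec (c • w) n = c • coreVec w n := by
  simp [coreVec, Finset.smul_sum]

theorem create_annihilate_coreVec (k : Fin N) (w : SP → ℂ) (n : Occ N) :
    create k (annihilate k (coreVec w n)) = (n k : ℂ) • coreVec w n := by
  rw [annihilate_coreVec, map_smul, create_coreVec, smul_smul]
  by_cases h : n k = 0
  · simp [h]
  · have h1 : (lower k n k : ℝ) + 1 = n k := by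
      rw [← Nat.cast_succ]; congr 1
      simp [lower]; omega
    rw [raise_lower h, h1, ← Complex.ofReal_mul, Real.mul_self_sqrt (by positivity)]
    norm_cast

theorem hamiltonian_coreVec (E : Bath N) {AT : Matrix SP SP ℂ} {w : SP → ℂ} {a : ℝ}
    (hw : AT.mulVec w = (a : ℂ) • w) (n : Occ N) :
    hamiltonian E AT (coreVec w n) = (energy E n : ℂ) • coreVec w n +
      (a : ℂ) • ∑ k, (E.g k : ℂ) • (lowerFam k (coreVec w) n + raiseFam k (coreVec w) n) := by
  have h1 : bathHamiltonian E (coreVec w n) = (energy E n : ℂ) • coreVec w n := by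
    rw [bathHamiltonian, LinearMap.sum_apply, energy, Complex.ofReal_sum, Finset.sum_smul]
    refine Finset.sum_congr rfl fun k _ => ?_
    rw [LinearMap.smul_apply, LinearMap.add_apply, LinearMap.comp_apply, create_annihilate_coreVec,
      LinearMap.smul_apply, LinearMap.id_apply, ← add_smul, smul_smul]
    push_cast
    rfl
  have h2 : couplingHamiltonian E AT (coreVec w n) =
      (a : ℂ) • ∑ k, (E.g k : ℂ) • (lowerFam k (coreVec w) n + raiseFam k (coreVec w) n) := by
    rw [couplingHamiltonian, LinearMap.sum_apply, Finset.smul_sum]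
    refine Finset.sum_congr rfl fun k _ => ?_
    rw [LinearMap.smul_apply, LinearMap.comp_apply, LinearMap.add_apply, annihilate_coreVec,
      create_coreVec, map_add, map_smul, map_smul, onSP_coreVec, onSP_coreVec, hw, coreVec_smul,
      coreVec_smul, lowerFam, raiseFam, smul_comm (a : ℂ) (E.g k : ℂ), smul_add (a : ℂ),
      smul_comm (a : ℂ), smul_comm (a : ℂ)]
  rw [hamiltonian, LinearMap.add_apply, h1, h2]

/-- The Schrödinger equation for the evolution of `w ⊗ |n⟩`, with `w` an eigenvector. -/
theorem IsPropagator.hasDerivAt_coreVec {E : Bath N} {AT : Matrix SP SP ℂ}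
    {X : ℝ → Total N →L[ℂ] Total N} (hX : IsPropagator E AT X) {w : SP → ℂ} {a : ℝ}
    (hw : AT.mulVec w = (a : ℂ) • w) {G : Type*} [NormedAddCommGroup G] [NormedSpace ℂ G]
    (T : Total N →L[ℂ] G) (n : Occ N) (t : ℝ) :
    HasDerivAt (fun t => T (X t (embed N (coreVec w n))))
      (-genFam E a (fun m => T (X t (embed N (coreVec w m)))) n) t := by
  refine ((T.restrictScalars ℝ).hasFDerivAt.comp_hasDerivAt t
    (hX.hasDerivAt_apply (coreVec w n) t)).congr_deriv ?_
  rw [hamiltonian_coreVec E hw]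
  simp only [genFam, lowerFam, raiseFam, ContinuousLinearMap.coe_restrictScalars', map_add,
    map_smul, map_sum, neg_smul, map_neg]

theorem embed_coreVec (w : SP → ℂ) (n : Occ N) :
    embed N (coreVec w n) = ∑ a, w a • ket (a, n) := by
  simp [embed, coreVec, map_sum]

end IncoherentControl

namespace IncoherentControl

open scoped Matrix

variable {N : ℕ}

/-! ## Bell states -/

/-- The unitary matrix whose columns are the vectors of the basis `u`. -/
noncomputable def basisMat (u : QubitBasis) : Matrix (Fin 2) (Fin 2) ℂ := Matrix.of fun a i => u i a

/-- The matrix whose columns are the Bell states. -/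
noncomputable def bellMat (u v : QubitBasis) : Matrix SP (Fin 4) ℂ :=
  Matrix.of fun a i => bell u v i a

/-- The coefficients of the Bell states in the product basis, up to the factor `1 / √2`. -/
def bellSigns : Matrix SP (Fin 4) ℂ := Matrix.of fun a =>
  (![![![1, 1, 0, 0], ![0, 0, 1, 1]], ![![0, 0, 1, -1], ![1, -1, 0, 0]]] :
    Fin 2 → Fin 2 → Fin 4 → ℂ) a.1 a.2

theorem basisMat_conjTranspose_mul (u : QubitBasis) : (basisMat u)ᴴ * basisMat u = 1 := by
  ext i j
  have h := orthonormal_iff_ite.1 u.orthonormal i j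
  rw [PiLp.inner_apply] at h
  simp only [Matrix.mul_apply, Matrix.conjTranspose_apply, basisMat, Matrix.of_apply,
    Matrix.one_apply]
  rw [← h]
  exact Finset.sum_congr rfl fun a _ => mul_comm _ _

theorem basisMat_mul_conjTranspose (u : QubitBasis) : basisMat u * (basisMat u)ᴴ = 1 :=
  mul_eq_one_comm.1 (basisMat_conjTranspose_mul u)

theorem bellMat_eq (u v : QubitBasis) : bellMat u v =
    (basisMat u ⊗ₖ basisMat v) * (((1 / Real.sqrt 2 : ℝ) : ℂ) • bellSigns) := by
  ext ⟨a, b⟩ i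
  simp only [bellMat, Matrix.mul_apply, Matrix.of_apply, Fintype.sum_prod_type, Fin.sum_univ_two,
    Matrix.kroneckerMap_apply, basisMat, Matrix.smul_apply, bellSigns, bell]
  fin_cases i <;> simp [tensorVec] <;> ring

theorem inv_sqrt_two_mul_self :
    ((1 / Real.sqrt 2 : ℝ) : ℂ) * ((1 / Real.sqrt 2 : ℝ) : ℂ) = 1 / 2 := by
  rw [← Complex.ofReal_mul, div_mul_div_comm, Real.mul_self_sqrt (by norm_num)]
  norm_num

theorem bellSigns_conjTranspose_mul : bellSignsᴴ * bellSigns = (2 : ℂ) • 1 := by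
  ext i j
  simp only [Matrix.mul_apply, Matrix.conjTranspose_apply, bellSigns, Matrix.of_apply,
    Fintype.sum_prod_type, Fin.sum_univ_two, Matrix.smul_apply, Matrix.one_apply]
  fin_cases i <;> fin_cases j <;> simp <;> norm_num

theorem kronecker_basisMat_conjTranspose_mul (u v : QubitBasis) :
    (basisMat u ⊗ₖ basisMat v)ᴴ * (basisMat u ⊗ₖ basisMat v) = 1 := by
  rw [Matrix.conjTranspose_kronecker, ← Matrix.mul_kronecker_mul, basisMat_conjTranspose_mul,
    basisMat_conjTranspose_mul, Matrix.one_kronecker_one]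

theorem bellMat_conjTranspose_mul (u v : QubitBasis) : (bellMat u v)ᴴ * bellMat u v = 1 := by
  rw [bellMat_eq, Matrix.conjTranspose_mul, Matrix.mul_assoc, ← Matrix.mul_assoc (_ ⊗ₖ _)ᴴ,
    kronecker_basisMat_conjTranspose_mul, Matrix.one_mul, Matrix.conjTranspose_smul,
    Matrix.smul_mul, Matrix.mul_smul, bellSigns_conjTranspose_mul, smul_smul, smul_smul,
    RCLike.star_def, Complex.conj_ofReal, inv_sqrt_two_mul_self]
  norm_num

theorem bellMat_mul_conjTranspose (u v : QubitBasis) : bellMat u v * (bellMat u v)ᴴ = 1 := by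
  -- Rows and columns have different index types, so a bijection between them is needed for a left
  -- inverse to be a right inverse.
  refine (Matrix.mul_eq_one_comm_of_equiv (e := ?_)).1 (bellMat_conjTranspose_mul u v)
  exact (finProdFinEquiv (m := 2) (n := 2)).symm

theorem sum_star_bell_mul_bell (u v : QubitBasis) (k i : Fin 4) :
    ∑ a, star (bell u v k a) * bell u v i a = if k = i then 1 else 0 := by
  have := congrFun (congrFun (bellMat_conjTranspose_mul u v) k) i
  simpa [Matrix.mul_apply, bellMat, Matrix.one_apply] using this

theorem sum_bell_mul_star_bell (u v : QubitBasis) (a c : SP) :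
    ∑ i, bell u v i a * star (bell u v i c) = if a = c then 1 else 0 := by
  have := congrFun (congrFun (bellMat_mul_conjTranspose u v) a) c
  simpa [Matrix.mul_apply, bellMat, Matrix.one_apply] using this

/-- The component `⟨bell k|ψ⟩` of a vector of the total Hilbert space. -/
noncomputable def bellSlice (u v : QubitBasis) (k : Fin 4) : Total N →L[ℂ] BathSpace N :=
  ∑ a, star (bell u v k a) • slice a

theorem bellSlice_apply (u v : QubitBasis) (k : Fin 4) (ψ : Total N) :
    bellSlice u v k ψ = ∑ a, star (bell u v k a) • slice a ψ := by
  simp [bellSlice]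

theorem sum_norm_sq_bell (u v : QubitBasis) (k : Fin 4) : ∑ a, ‖bell u v k a‖ ^ 2 = 1 := by
  have h := sum_star_bell_mul_bell u v k k
  rw [if_pos rfl] at h
  have h2 : ∀ a, star (bell u v k a) * bell u v k a = ((‖bell u v k a‖ ^ 2 : ℝ) : ℂ) := fun a => by
    rw [RCLike.star_def, Complex.conj_mul']; push_cast; rfl
  simp only [h2, ← Complex.ofReal_sum] at h
  exact_mod_cast h

theorem norm_bellSlice_le (u v : QubitBasis) (k : Fin 4) (ψ : Total N) :
    ‖bellSlice u v k ψ‖ ≤ ‖ψ‖ := by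
  have h2 : ‖bellSlice u v k ψ‖ ≤ ∑ a, ‖bell u v k a‖ * ‖slice a ψ‖ := by
    rw [bellSlice_apply]
    refine (norm_sum_le _ _).trans (Finset.sum_le_sum fun a _ => ?_)
    rw [norm_smul, norm_star]
  have h3 := Finset.sum_mul_sq_le_sq_mul_sq Finset.univ (fun a => ‖bell u v k a‖)
    fun a => ‖slice a ψ‖
  rw [sum_norm_sq_bell, one_mul, sum_norm_sq_slice] at h3
  exact h2.trans (le_of_sq_le_sq h3 (norm_nonneg _))

theorem slice_eq_sum_bellSlice (u v : QubitBasis) (a : SP) (ψ : Total N) :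
    slice a ψ = ∑ k, bell u v k a • bellSlice u v k ψ := by
  simp only [bellSlice_apply, Finset.smul_sum, smul_smul]
  rw [Finset.sum_comm]
  simp only [← Finset.sum_smul, sum_bell_mul_star_bell]
  simp

theorem slice_embed (a : SP) (w : SP → ℂ) (n : Occ N) :
    slice a (embed N (coreVec w n)) = w a • lp.single 2 n (1 : ℂ) := by
  rw [embed_coreVec, map_sum, Finset.sum_eq_single a, map_smul, slice_ket, if_pos rfl]
  · intro b _ hb
    rw [map_smul, slice_ket, if_neg (Ne.symm hb), smul_zero]
  · simp

theorem bellSlice_embed (u v : QubitBasis) (k i : Fin 4) (n : Occ N) :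
    bellSlice u v k (embed N (coreVec (bell u v i) n)) =
      (if k = i then (1 : ℂ) else 0) • lp.single 2 n (1 : ℂ) := by
  simp only [← sum_star_bell_mul_bell u v, bellSlice_apply, Finset.sum_smul, slice_embed, smul_smul]

theorem norm_embed_bell (u v : QubitBasis) (i : Fin 4) (n : Occ N) :
    ‖embed N (coreVec (bell u v i) n)‖ = 1 := by
  have h1 := sum_norm_sq_slice (embed N (coreVec (bell u v i) n))
  have h2 : ∀ a, ‖slice a (embed N (coreVec (bell u v i) n))‖ ^ 2 = ‖bell u v i a‖ ^ 2 := fun a => by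
    rw [slice_embed, norm_smul, lp.norm_single (by norm_num), norm_one, mul_one]
  simp only [h2, sum_norm_sq_bell] at h1
  exact (pow_eq_one_iff_of_nonneg (norm_nonneg _) two_ne_zero).1 h1.symm

/-! ## The branches of the evolution -/

section Branches

variable {E : Bath N} {AT : Matrix SP SP ℂ} {u v : QubitBasis} {α : Fin 4 → ℝ}
  {X : ℝ → Total N →L[ℂ] Total N}

/-- The state of the bath at time `t` when `S + P` is in the `i`-th Bell state and the bath starts
in the number state `|n⟩`. -/
noncomputable def branch (u v : QubitBasis) (X : ℝ → Total N →L[ℂ] Total N) (i : Fin 4) (n : Occ N)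
    (t : ℝ) : BathSpace N :=
  bellSlice u v i (X t (embed N (coreVec (bell u v i) n)))

theorem norm_bellSlice_propagator_le (hX : IsPropagator E AT X) (k i : Fin 4) (n : Occ N) (t : ℝ) :
    ‖bellSlice u v k (X t (embed N (coreVec (bell u v i) n)))‖ ≤ 1 :=
  (norm_bellSlice_le u v k _).trans (by rw [hX.norm_apply, norm_embed_bell])

/-- Each Bell component of the evolved vector solves the Schrödinger equation with coupling `α i`.
The components `k ≠ i` start at zero, so uniqueness keeps them there. -/
theorem bellSlice_propagator_of_ne (hX : IsPropagator E AT X)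
    (hBell : ∀ i, AT.mulVec (bell u v i) = (α i : ℂ) • bell u v i) {k i : Fin 4} (h : k ≠ i)
    (n : Occ N) (t : ℝ) : bellSlice u v k (X t (embed N (coreVec (bell u v i) n))) = 0 :=
  eq_zero_of_schroedinger E (α i)
    (F := fun n t => bellSlice u v k (X t (embed N (coreVec (bell u v i) n)))) (C := 1)
    (hX.hasDerivAt_coreVec (hBell i) (bellSlice u v k))
    (norm_bellSlice_propagator_le hX k i)
    (fun n => by simp [hX.zero, bellSlice_embed, h]) n t

theorem genFam_map {V W : Type*} [AddCommGroup V] [Module ℂ V] [AddCommGroup W] [Module ℂ W]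
    (T : V →ₗ[ℂ] W) (a : ℝ) (f : Occ N → V) (n : Occ N) :
    T (genFam E a f n) = genFam E a (fun n => T (f n)) n := by
  simp [genFam, lowerFam, raiseFam]

theorem inner_genFam_right {H : Type*} [NormedAddCommGroup H] [InnerProductSpace ℂ H] (a : ℝ)
    (x : H) (f : Occ N → H) (n : Occ N) :
    inner ℂ x (genFam E a f n) = genFam E a (fun m => inner ℂ x (f m)) n :=
  genFam_map (innerSL ℂ x).toLinearMap a f n

theorem inner_genFam_left {H : Type*} [NormedAddCommGroup H] [InnerProductSpace ℂ H] (a : ℝ)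
    (x : H) (f : Occ N → H) (n : Occ N) :
    inner ℂ (genFam E a f n) x = -genFam E a (fun m => inner ℂ (f m) x) n := by
  rw [← inner_conj_symm, inner_genFam_right, ← RCLike.star_def, conj_genFam]
  simp only [RCLike.star_def, inner_conj_symm]

theorem isOverlap_branch (hX : IsPropagator E AT X)
    (hBell : ∀ i, AT.mulVec (bell u v i) = (α i : ℂ) • bell u v i) (j i : Fin 4) :
    IsOverlap E (α j) (α i) fun n m t => inner ℂ (branch u v X j n t) (branch u v X i m t) where
  zero n m := by
    simp only [branch, hX.zero, one_apply_eq_self, bellSlice_embed, if_true, one_smul]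
    rw [lp.inner_single_left, lp.single_apply]
    simp [Pi.single_apply]
  norm_le n m t := by
    refine (norm_inner_le_norm _ _).trans ?_
    have h1 := norm_bellSlice_propagator_le (u := u) (v := v) hX j j n t
    have h2 := norm_bellSlice_propagator_le (u := u) (v := v) hX i i m t
    exact mul_le_one₀ h1 (norm_nonneg _) h2
  hasDerivAt n m t := by
    have h1 : HasDerivAt (branch u v X j n) _ t :=
      hX.hasDerivAt_coreVec (hBell j) (bellSlice u v j) n t
    have h2 : HasDerivAt (branch u v X i m) _ t :=
      hX.hasDerivAt_coreVec (hBell i) (bellSlice u v i) m t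
    refine (h1.inner ℂ h2).congr_deriv ?_
    rw [inner_neg_left, inner_neg_right, inner_genFam_left, inner_genFam_right]
    simp only [branch]
    ring

/-- The inner product is antilinear in its first argument, so `γ_ij` comes from branch `j` on the
left and branch `i` on the right. -/
theorem hasSum_branch (hX : IsPropagator E AT X)
    (hBell : ∀ i, AT.mulVec (bell u v i) = (α i : ℂ) • bell u v i) (j i : Fin 4) (t : ℝ) :
    HasSum (fun m => (thermalWeight E m : ℂ) *
      inner ℂ (branch u v X j m t) (branch u v X i m t)) (gam E α i j t) := by
  have hS := isOverlap_branch hX hBell j i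
  have h := (summable_thermalWeight_mul_of_le_one E fun m => hS.norm_le m m t).hasSum
  rwa [show ∑' m, _ = gam E α i j t from hS.thermalOverlap_eq t] at h

theorem slice_propagator_ket (hX : IsPropagator E AT X)
    (hBell : ∀ i, AT.mulVec (bell u v i) = (α i : ℂ) • bell u v i) (a c : SP) (m : Occ N) (t : ℝ) :
    slice a (X t (ket (c, m))) =
      ∑ i, (bell u v i a * star (bell u v i c)) • branch u v X i m t := by
  have h1 : ket (c, m) = ∑ i, star (bell u v i c) • embed N (coreVec (bell u v i) m) := by
    simp only [embed_coreVec, Finset.smul_sum, smul_smul]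
    rw [Finset.sum_comm]
    simp only [← Finset.sum_smul, mul_comm (star _), sum_bell_mul_star_bell]
    simp
  rw [h1, map_sum, map_sum]
  refine Finset.sum_congr rfl fun i _ => ?_
  rw [map_smul, map_smul, slice_eq_sum_bellSlice u v, Finset.sum_eq_single i]
  · rw [smul_smul, mul_comm]; rfl
  · intro k _ hk
    rw [bellSlice_propagator_of_ne hX hBell hk, smul_zero]
  · simp

/-- Pure dephasing: in the Bell basis the reduced evolution of `S + P` is entrywise multiplication
by `γ_ij`. -/
theorem traceE_propagator (hX : IsPropagator E AT X)
    (hBell : ∀ i, AT.mulVec (bell u v i) = (α i : ℂ) • bell u v i) (ρ : Matrix SP SP ℂ) (t : ℝ) :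
    traceE (X t * initialState E ρ * star (X t)) =
      bellMat u v * Matrix.of (fun i j => gam E α i j t * ((bellMat u v)ᴴ * ρ * bellMat u v) i j) *
        (bellMat u v)ᴴ := by
  ext a b
  rw [traceE_conj_initialState E ρ (fun ψ => (hX.norm_apply t ψ).le)]
  have hs : ∀ c d, HasSum (fun m => (thermalWeight E m : ℂ) *
      inner ℂ (slice b (X t (ket (d, m)))) (slice a (X t (ket (c, m)))))
      (∑ i, ∑ j, bell u v i a * star (bell u v i c) * (star (bell u v j b) * bell u v j d) *
        gam E α i j t) := by
    intro c d
    refine (hasSum_sum fun i (_ : i ∈ Finset.univ) => hasSum_sum fun j (_ : j ∈ Finset.univ) =>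
      (hasSum_branch hX hBell j i t).mul_left
        (bell u v i a * star (bell u v i c) * (star (bell u v j b) * bell u v j d))).congr_fun
        fun m => ?_
    simp only [slice_propagator_ket hX hBell, sum_inner, inner_sum, inner_smul_left,
      inner_smul_right, Finset.mul_sum, map_mul, RCLike.star_def, Complex.conj_conj]
    exact Finset.sum_congr rfl fun i _ => Finset.sum_congr rfl fun j _ => by ring
  simp only [(hs _ _).tsum_eq, Matrix.mul_apply, Matrix.of_apply, Matrix.conjTranspose_apply,
    bellMat, Finset.sum_mul, Finset.mul_sum]
  rw [Finset.sum_comm]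
  refine (Finset.sum_congr rfl fun d _ => Finset.sum_congr rfl fun c _ => Finset.sum_comm).trans ?_
  refine (Finset.sum_congr rfl fun d _ => Finset.sum_comm).trans ?_
  rw [Finset.sum_comm]
  refine Finset.sum_congr rfl fun j _ => ?_
  refine (Finset.sum_congr rfl fun d _ => Finset.sum_comm).trans ?_
  rw [Finset.sum_comm]
  refine Finset.sum_congr rfl fun i _ => Finset.sum_congr rfl fun d _ =>
    Finset.sum_congr rfl fun c _ => ?_
  ring

end Branches

end IncoherentControl

namespace IncoherentControl

open scoped Matrix

variable {N : ℕ}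

/-! ## Coherence vectors -/

/-- The density matrix with coherence vector `s`, with respect to the standard basis. -/
noncomputable def stdBloch (s : Fin 3 → ℝ) : Matrix (Fin 2) (Fin 2) ℂ :=
  (1 / 2 : ℂ) • !![1 + (s 2 : ℂ), s 0 - Complex.I * s 1; s 0 + Complex.I * s 1, 1 - (s 2 : ℂ)]

theorem pauliIn_eq (u : QubitBasis) (k : Fin 3) :
    pauliIn u k = basisMat u * pauli k * (basisMat u)ᴴ := by
  ext a b
  simp only [pauliIn, Matrix.sum_apply, Matrix.add_apply, Matrix.smul_apply, Matrix.of_apply,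
    Matrix.mul_apply, basisMat, Matrix.conjTranspose_apply, Fin.sum_univ_two, smul_eq_mul]
  ring

theorem ofBloch_eq (u : QubitBasis) (s : Fin 3 → ℝ) :
    ofBloch u s = basisMat u * stdBloch s * (basisMat u)ᴴ := by
  have h : stdBloch s = (1 / 2 : ℂ) • (1 + ∑ k, (s k : ℂ) • pauli k) := by
    ext i j
    fin_cases i <;> fin_cases j <;>
      simp [stdBloch, pauli, Fin.sum_univ_three] <;> ring
  rw [h, ofBloch, Matrix.mul_smul, Matrix.smul_mul, Matrix.mul_add, Matrix.add_mul, Matrix.mul_one,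
    basisMat_mul_conjTranspose, Matrix.mul_sum, Matrix.sum_mul]
  simp only [pauliIn_eq, Matrix.mul_smul, Matrix.smul_mul]

/-- A local change of basis on `P` drops out of the trace over `P`; this reduces arbitrary bases to
the standard one. -/
theorem traceP_kronecker (V W : Matrix (Fin 2) (Fin 2) ℂ) (hW : Wᴴ * W = 1) (M : Matrix SP SP ℂ) :
    traceP ((V ⊗ₖ W) * M * (V ⊗ₖ W)ᴴ) = V * traceP M * Vᴴ := by
  have h : ∀ i j, star (W 0 i) * W 0 j + star (W 1 i) * W 1 j = if i = j then 1 else 0 := by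
    intro i j
    have := congrFun (congrFun hW i) j
    simpa [Matrix.mul_apply, Fin.sum_univ_two, Matrix.one_apply] using this
  have h00 := h 0 0
  have h01 := h 0 1
  have h10 := h 1 0
  have h11 := h 1 1
  simp only [Fin.isValue, if_true, zero_ne_one, one_ne_zero, if_false] at h00 h01 h10 h11
  ext i j
  simp only [traceP, Matrix.of_apply, Matrix.mul_apply, Matrix.conjTranspose_apply,
    Matrix.kroneckerMap_apply, Fintype.sum_prod_type, Fin.sum_univ_two, star_mul']
  linear_combination
    (V i 0 * M (0, 0) (0, 0) * star (V j 0) + V i 1 * M (1, 0) (0, 0) * star (V j 0) +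
      V i 0 * M (0, 0) (1, 0) * star (V j 1) + V i 1 * M (1, 0) (1, 0) * star (V j 1)) * h00 +
    (V i 0 * M (0, 1) (0, 1) * star (V j 0) + V i 1 * M (1, 1) (0, 1) * star (V j 0) +
      V i 0 * M (0, 1) (1, 1) * star (V j 1) + V i 1 * M (1, 1) (1, 1) * star (V j 1)) * h11 +
    (V i 0 * M (0, 1) (0, 0) * star (V j 0) + V i 1 * M (1, 1) (0, 0) * star (V j 0) +
      V i 0 * M (0, 1) (1, 0) * star (V j 1) + V i 1 * M (1, 1) (1, 0) * star (V j 1)) * h01 +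
    (V i 0 * M (0, 0) (0, 1) * star (V j 0) + V i 1 * M (1, 0) (0, 1) * star (V j 0) +
      V i 0 * M (0, 0) (1, 1) * star (V j 1) + V i 1 * M (1, 0) (1, 1) * star (V j 1)) * h10

/-- The evolution of the reduced state in the standard basis, up to a factor. -/
theorem traceP_bellSigns {γ : Fin 4 → Fin 4 → ℂ} (h1 : ∀ i, γ i i = 1)
    (h2 : ∀ i j, γ i j = star (γ j i)) (s p q : Fin 3 → ℝ)
    (hq : q = ![(1 / 2) * ((γ 0 2 - γ 1 3).re * p 0 + s 2 * (γ 0 2 - γ 1 3).im * p 1 +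
        s 1 * (γ 0 2 + γ 1 3).im * p 2 + s 0 * (γ 0 2 + γ 1 3).re),
      (1 / 2) * (s 2 * (γ 0 3 - γ 1 2).im * p 0 + (γ 1 2 - γ 0 3).re * p 1 -
        s 0 * (γ 1 2 + γ 0 3).im * p 2 + s 1 * (γ 1 2 + γ 0 3).re),
      (1 / 2) * (-s 1 * (γ 0 1 + γ 2 3).im * p 0 + s 0 * (γ 2 3 - γ 0 1).im * p 1 +
        (γ 0 1 - γ 2 3).re * p 2 + s 2 * (γ 0 1 + γ 2 3).re)]) :
    traceP (bellSigns * Matrix.of (fun i j =>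
      γ i j * (bellSignsᴴ * (stdBloch s ⊗ₖ stdBloch p) * bellSigns) i j) * bellSignsᴴ) =
      (4 : ℂ) • stdBloch q := by
  have d : ∀ z : ℂ, z = z.re + z.im * Complex.I := fun z => (Complex.re_add_im z).symm
  have d' : ∀ z : ℂ, star z = z.re - z.im * Complex.I := fun z => by
    rw [RCLike.star_def]; apply Complex.ext <;> simp
  have e10 := h2 1 0
  have e20 := h2 2 0
  have e30 := h2 3 0
  have e21 := h2 2 1
  have e31 := h2 3 1
  have e32 := h2 3 2
  rw [d'] at e10 e20 e30 e21 e31 e32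
  have e01 := d (γ 0 1)
  have e02 := d (γ 0 2)
  have e03 := d (γ 0 3)
  have e12 := d (γ 1 2)
  have e13 := d (γ 1 3)
  have e23 := d (γ 2 3)
  subst hq
  simp only [Complex.add_re, Complex.sub_re, Complex.add_im, Complex.sub_im]
  generalize (γ 0 1).re = a01 at *
  generalize (γ 0 2).re = a02 at *
  generalize (γ 0 3).re = a03 at *
  generalize (γ 1 2).re = a12 at *
  generalize (γ 1 3).re = a13 at *
  generalize (γ 2 3).re = a23 at *
  generalize (γ 0 1).im = b01 at *
  generalize (γ 0 2).im = b02 at *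
  generalize (γ 0 3).im = b03 at *
  generalize (γ 1 2).im = b12 at *
  generalize (γ 1 3).im = b13 at *
  generalize (γ 2 3).im = b23 at *
  have I2 := Complex.I_sq
  ext i j
  simp only [traceP, Matrix.of_apply, Matrix.mul_apply, Matrix.conjTranspose_apply,
    Matrix.kroneckerMap_apply, Fintype.sum_prod_type, Fin.sum_univ_two, Fin.sum_univ_four, h1,
    e10, e20, e30, e21, e31, e32, e01, e02, e03, e12, e13, e23]
  -- With the real and imaginary parts of `γ` as free variables, each entry is a polynomial identity
  -- modulo `I² = -1`. The factor `4` makes up for the four omitted normalisations `1 / √2`.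
  fin_cases i <;> fin_cases j <;> simp [bellSigns, stdBloch] <;> ring_nf <;>
    simp only [Complex.I_sq] <;> ring

theorem gam_self (E : Bath N) (α : Fin 4 → ℝ) (i : Fin 4) (t : ℝ) : gam E α i i t = 1 := by
  simp [gam]

theorem gam_conj (E : Bath N) (α : Fin 4 → ℝ) (i j : Fin 4) (t : ℝ) :
    gam E α i j t = star (gam E α j i t) := by
  rw [gam, gam, RCLike.star_def, ← Complex.exp_conj]
  simp only [map_add, map_mul, Complex.conj_ofReal, Complex.conj_I]
  congr 1
  push_cast
  ring

theorem affine_eq (E : Bath N) (α : Fin 4 → ℝ) (t : ℝ) (s p : Fin 3 → ℝ) :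
    (affineMatrix E α t s).mulVec p + affineVector E α t s =
      let γ : Fin 4 → Fin 4 → ℂ := fun i j => gam E α i j t
      ![(1 / 2) * ((γ 0 2 - γ 1 3).re * p 0 + s 2 * (γ 0 2 - γ 1 3).im * p 1 +
        s 1 * (γ 0 2 + γ 1 3).im * p 2 + s 0 * (γ 0 2 + γ 1 3).re),
      (1 / 2) * (s 2 * (γ 0 3 - γ 1 2).im * p 0 + (γ 1 2 - γ 0 3).re * p 1 -
        s 0 * (γ 1 2 + γ 0 3).im * p 2 + s 1 * (γ 1 2 + γ 0 3).re),
      (1 / 2) * (-s 1 * (γ 0 1 + γ 2 3).im * p 0 + s 0 * (γ 2 3 - γ 0 1).im * p 1 +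
        (γ 0 1 - γ 2 3).re * p 2 + s 2 * (γ 0 1 + γ 2 3).re)] := by
  ext k
  fin_cases k <;> simp [affineMatrix, affineVector, Matrix.mulVec, dotProduct, Fin.sum_univ_three] <;>
    ring

/-- The affine form of the evolution of the reduced state. -/
theorem evolve_ofBloch {E : Bath N} {AT : Matrix SP SP ℂ} {u v : QubitBasis} {α : Fin 4 → ℝ}
    {X : ℝ → Total N →L[ℂ] Total N} (hX : IsPropagator E AT X)
    (hBell : ∀ i, AT.mulVec (bell u v i) = (α i : ℂ) • bell u v i) (t : ℝ) (s p : Fin 3 → ℝ) :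
    evolve E X t (ofBloch u s) (ofBloch v p) =
      ofBloch u ((affineMatrix E α t s).mulVec p + affineVector E α t s) := by
  set W := basisMat u ⊗ₖ basisMat v with hW
  have hρ : ofBloch u s ⊗ₖ ofBloch v p = W * (stdBloch s ⊗ₖ stdBloch p) * Wᴴ := by
    rw [ofBloch_eq, ofBloch_eq, Matrix.mul_kronecker_mul, Matrix.mul_kronecker_mul,
      Matrix.conjTranspose_kronecker]
  -- The inner pair of Bell matrices contributes `1 / 2`; in `hB` the outer pair brings this to `1 /
  -- 4`, cancelling the `4` of `traceP_bellSigns`.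
  have hM : (bellMat u v)ᴴ * (ofBloch u s ⊗ₖ ofBloch v p) * bellMat u v =
      (1 / 2 : ℂ) • (bellSignsᴴ * (stdBloch s ⊗ₖ stdBloch p) * bellSigns) := by
    rw [hρ, bellMat_eq, ← hW, Matrix.conjTranspose_mul]
    have hWW : Wᴴ * W = 1 := kronecker_basisMat_conjTranspose_mul u v
    calc _ = (((1 / Real.sqrt 2 : ℝ) : ℂ) • bellSigns)ᴴ * (Wᴴ * W) * (stdBloch s ⊗ₖ stdBloch p) *
          (Wᴴ * W) * (((1 / Real.sqrt 2 : ℝ) : ℂ) • bellSigns) := by simp only [Matrix.mul_assoc]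
      _ = _ := by
        rw [hWW, Matrix.mul_one, Matrix.mul_one, Matrix.conjTranspose_smul, Matrix.smul_mul,
          Matrix.smul_mul, Matrix.mul_smul, smul_smul, RCLike.star_def, Complex.conj_ofReal,
          inv_sqrt_two_mul_self]
  have hG : Matrix.of (fun i j => gam E α i j t *
      ((1 / 2 : ℂ) • (bellSignsᴴ * (stdBloch s ⊗ₖ stdBloch p) * bellSigns)) i j) =
      (1 / 2 : ℂ) • Matrix.of (fun i j => gam E α i j t *
        (bellSignsᴴ * (stdBloch s ⊗ₖ stdBloch p) * bellSigns) i j) := by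
    ext i j
    simp only [Matrix.of_apply, Matrix.smul_apply, smul_eq_mul]
    ring
  rw [evolve, traceE_propagator hX hBell, hM, hG]
  set G := Matrix.of (fun i j => gam E α i j t *
    (bellSignsᴴ * (stdBloch s ⊗ₖ stdBloch p) * bellSigns) i j) with hGdef
  have hB : bellMat u v * ((1 / 2 : ℂ) • G) * (bellMat u v)ᴴ =
      W * ((1 / 4 : ℂ) • (bellSigns * G * bellSignsᴴ)) * Wᴴ := by
    rw [bellMat_eq, ← hW, Matrix.conjTranspose_mul, Matrix.conjTranspose_smul, RCLike.star_def,
      Complex.conj_ofReal]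
    have h4 : ((1 / Real.sqrt 2 : ℝ) : ℂ) * ((1 / 2) * ((1 / Real.sqrt 2 : ℝ) : ℂ)) = 1 / 4 := by
      linear_combination (1 / 2 : ℂ) * inv_sqrt_two_mul_self
    simp only [Matrix.mul_smul, Matrix.smul_mul, smul_smul, Matrix.mul_assoc]
    rw [h4]
  have hT : ∀ M : Matrix SP SP ℂ, traceP ((1 / 4 : ℂ) • M) = (1 / 4 : ℂ) • traceP M := fun M => by
    ext i j
    simp [traceP, mul_add]
  rw [hB, traceP_kronecker _ _ (basisMat_conjTranspose_mul v), hT, hGdef,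
    traceP_bellSigns (fun i => gam_self E α i t) (fun i j => gam_conj E α i j t) s p _
      (affine_eq E α t s p), smul_smul, ofBloch_eq]
  norm_num

end IncoherentControl

namespace IncoherentControl

open scoped Matrix

variable {N : ℕ}

/-! ## Short-time behaviour of the affine map -/

/-- Taylor's formula with analytic remainder, valid for every `y`, so that later expansions are
exact identities rather than asymptotic estimates. -/
theorem exists_sin_eq : ∃ G : ℝ → ℝ, AnalyticAt ℝ G 0 ∧ ∀ y, Real.sin y = y + y ^ 3 * G y := by
  obtain ⟨G, hG, h⟩ := (Real.analyticAt_sin (x := 0)).exists_eq_sum_add_pow_mul 3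
  refine ⟨G, hG, fun y => (h y).trans ?_⟩
  simp [Finset.sum_range_succ, iteratedDeriv_succ]

theorem exists_cos_eq : ∃ G : ℝ → ℝ, AnalyticAt ℝ G 0 ∧
    ∀ y, Real.cos y = 1 - y ^ 2 / 2 + y ^ 3 * G y := by
  obtain ⟨G, hG, h⟩ := (Real.analyticAt_cos (x := 0)).exists_eq_sum_add_pow_mul 3
  refine ⟨G, hG, fun y => (h y).trans ?_⟩
  simp [Finset.sum_range_succ, iteratedDeriv_succ]
  ring

theorem exists_exp_eq : ∃ G : ℝ → ℝ, AnalyticAt ℝ G 0 ∧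
    ∀ y, Real.exp y = 1 + y + y ^ 2 * G y := by
  obtain ⟨G, hG, h⟩ := (analyticAt_rexp (x := 0)).exists_eq_sum_add_pow_mul 2
  refine ⟨G, hG, fun y => (h y).trans ?_⟩
  simp [Finset.sum_range_succ, iteratedDeriv_succ]

theorem exists_comp_eq {G q : ℝ → ℝ} (hG : AnalyticAt ℝ G 0) (hq : AnalyticAt ℝ q 0)
    (hq0 : q 0 = 0) : ∃ K : ℝ → ℝ, AnalyticAt ℝ K 0 ∧ ∀ t, K t = G (q t) :=
  ⟨fun t => G (q t), AnalyticAt.fun_comp (by rwa [hq0]) hq, fun _ => rfl⟩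

/-- Half the second derivative of `decay E` at `0`. -/
noncomputable def decayRate (E : Bath N) : ℝ :=
  ∑ i, (E.g i / (E.hbar * E.omega i)) ^ 2 * (1 + 2 * meanOccupation E i) * (E.omega i ^ 2 / 2)

theorem meanOccupation_pos (E : Bath N) (i : Fin N) : 0 < meanOccupation E i := by
  rw [meanOccupation_eq]
  exact div_pos (boltzmann_pos E i) (sub_pos.2 (boltzmann_lt_one E i))

theorem decayRate_pos {E : Bath N} (h : ∃ i, E.g i ≠ 0) : 0 < decayRate E := by
  obtain ⟨i, hi⟩ := h
  refine Finset.sum_pos' (fun j _ => ?_) ⟨i, Finset.mem_univ i, ?_⟩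
  · have := meanOccupation_pos E j
    positivity
  · have := meanOccupation_pos E i
    have := E.omega_pos i
    have := E.hbar_pos
    positivity

theorem exists_decay_eq (E : Bath N) : ∃ F : ℝ → ℝ, AnalyticAt ℝ F 0 ∧ F 0 = decayRate E ∧
    ∀ t, decay E t = t ^ 2 * F t := by
  obtain ⟨G, hG, h⟩ := exists_cos_eq
  refine ⟨fun t => ∑ i, (E.g i / (E.hbar * E.omega i)) ^ 2 * (1 + 2 * meanOccupation E i) *
    (E.omega i ^ 2 / 2 - E.omega i ^ 3 * t * G (E.omega i * t)), ?_, ?_, fun t => ?_⟩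
  · refine Finset.analyticAt_fun_sum _ fun i _ => ?_
    obtain ⟨K, hK, h1⟩ := exists_comp_eq (q := fun t => E.omega i * t) hG
      (by fun_prop) (mul_zero _)
    simp only [← h1]
    fun_prop
  · simp [decayRate]
  · rw [decay, Finset.mul_sum]
    refine Finset.sum_congr rfl fun i _ => ?_
    rw [h]; ring

/-- The linear term of the sine cancels `ω_i t`, so the phase is one order smaller than the decay.
-/
theorem exists_phase_eq (E : Bath N) : ∃ F : ℝ → ℝ, AnalyticAt ℝ F 0 ∧
    ∀ t, phase E t = t ^ 3 * F t := by
  obtain ⟨G, hG, h⟩ := exists_sin_eq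
  refine ⟨fun t => ∑ i, (E.g i / (E.hbar * E.omega i)) ^ 2 *
    (-E.omega i ^ 3 * G (E.omega i * t)), ?_, fun t => ?_⟩
  · refine Finset.analyticAt_fun_sum _ fun i _ => ?_
    obtain ⟨K, hK, h1⟩ := exists_comp_eq (q := fun t => E.omega i * t) hG
      (by fun_prop) (mul_zero _)
    simp only [← h1]
    fun_prop
  · rw [phase, Finset.mul_sum]
    refine Finset.sum_congr rfl fun i _ => ?_
    rw [h]; ring

theorem gam_re (E : Bath N) (α : Fin 4 → ℝ) (i j : Fin 4) (t : ℝ) : (gam E α i j t).re =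
    Real.exp (-(α i - α j) ^ 2 * decay E t) * Real.cos ((α i ^ 2 - α j ^ 2) * phase E t) := by
  rw [gam, Complex.exp_re, mul_comm Complex.I]
  simp only [Complex.add_re, Complex.add_im, Complex.ofReal_re, Complex.ofReal_im,
    Complex.re_ofReal_mul, Complex.im_ofReal_mul, Complex.I_re, Complex.I_im]
  simp

theorem gam_im (E : Bath N) (α : Fin 4 → ℝ) (i j : Fin 4) (t : ℝ) : (gam E α i j t).im =
    Real.exp (-(α i - α j) ^ 2 * decay E t) * Real.sin ((α i ^ 2 - α j ^ 2) * phase E t) := by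
  rw [gam, Complex.exp_im, mul_comm Complex.I]
  simp only [Complex.add_re, Complex.add_im, Complex.ofReal_re, Complex.ofReal_im,
    Complex.re_ofReal_mul, Complex.im_ofReal_mul, Complex.I_re, Complex.I_im]
  simp

/-- The phase enters the real part only through `cos`, at order `t⁶`, so the `t²` coefficient is
that of the decay factor. -/
theorem exists_gam_re_eq (E : Bath N) (α : Fin 4 → ℝ) (i j : Fin 4) : ∃ R : ℝ → ℝ,
    AnalyticAt ℝ R 0 ∧ R 0 = -(α i - α j) ^ 2 * decayRate E ∧
    ∀ t, (gam E α i j t).re = 1 + t ^ 2 * R t := by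
  obtain ⟨F, hF, hF0, hF'⟩ := exists_decay_eq E
  obtain ⟨P, hP, hP'⟩ := exists_phase_eq E
  obtain ⟨C, hC, hC'⟩ := exists_cos_eq
  obtain ⟨G, hG, hG'⟩ := exists_exp_eq
  set D := -(α i - α j) ^ 2
  set c := α i ^ 2 - α j ^ 2
  obtain ⟨G, hG, h1⟩ := exists_comp_eq (q := fun t => D * (t ^ 2 * F t)) hG (by fun_prop) (by simp)
  obtain ⟨C, hC, h2⟩ := exists_comp_eq (q := fun t => c * (t ^ 3 * P t)) hC (by fun_prop) (by simp)
  obtain ⟨X, hX, h3⟩ := exists_comp_eq (q := fun t => D * (t ^ 2 * F t)) analyticAt_rexp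
    (by fun_prop) (by simp)
  refine ⟨fun t => D * F t + t ^ 2 * (D * F t) ^ 2 * G t +
    X t * (c * P t) ^ 2 * t ^ 4 * (-1 / 2 + c * (t ^ 3 * P t) * C t), by fun_prop, ?_, fun t => ?_⟩
  · simp [hF0]
  · rw [gam_re, hF', hP', hC']
    have := hG' (D * (t ^ 2 * F t))
    simp only [h1, h2, h3, D, c] at this ⊢
    linear_combination this

theorem exists_gam_im_eq (E : Bath N) (α : Fin 4 → ℝ) (i j : Fin 4) : ∃ J : ℝ → ℝ,
    AnalyticAt ℝ J 0 ∧ ∀ t, (gam E α i j t).im = t ^ 3 * J t := by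
  obtain ⟨F, hF, -, hF'⟩ := exists_decay_eq E
  obtain ⟨P, hP, hP'⟩ := exists_phase_eq E
  obtain ⟨S, hS, hS'⟩ := exists_sin_eq
  set D := -(α i - α j) ^ 2
  set c := α i ^ 2 - α j ^ 2
  obtain ⟨S, hS, h2⟩ := exists_comp_eq (q := fun t => c * (t ^ 3 * P t)) hS (by fun_prop) (by simp)
  obtain ⟨X, hX, h3⟩ := exists_comp_eq (q := fun t => D * (t ^ 2 * F t)) analyticAt_rexp
    (by fun_prop) (by simp)
  refine ⟨fun t => X t * (c * P t + (c * P t) ^ 3 * t ^ 6 * S t), by fun_prop, fun t => ?_⟩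
  rw [gam_im, hF', hP', hS']
  simp only [h2, h3, D, c]
  ring

/-- The short-time expansion of the determinant of the affine map. -/
theorem exists_det_affineMatrix_eq (E : Bath N) (α : Fin 4 → ℝ) (s : Fin 3 → ℝ) : ∃ h : ℝ → ℝ,
    AnalyticAt ℝ h 0 ∧
    h 0 = (decayRate E) ^ 3 / 8 * (((α 1 - α 3) ^ 2 - (α 0 - α 2) ^ 2) *
      ((α 0 - α 3) ^ 2 - (α 1 - α 2) ^ 2) * ((α 2 - α 3) ^ 2 - (α 0 - α 1) ^ 2)) ∧
    ∀ t, (affineMatrix E α t s).det = t ^ 6 * h t := by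
  choose R hR hR0 hR' using exists_gam_re_eq E α
  choose J hJ hJ' using exists_gam_im_eq E α
  let d0 := fun t => R 0 2 t - R 1 3 t
  let d1 := fun t => R 1 2 t - R 0 3 t
  let d2 := fun t => R 0 1 t - R 2 3 t
  let o01 := fun t => s 2 * (J 0 2 t - J 1 3 t)
  let o02 := fun t => s 1 * (J 0 2 t + J 1 3 t)
  let o10 := fun t => s 2 * (J 0 3 t - J 1 2 t)
  let o12 := fun t => -s 0 * (J 1 2 t + J 0 3 t)
  let o20 := fun t => -s 1 * (J 0 1 t + J 2 3 t)
  let o21 := fun t => s 0 * (J 2 3 t - J 0 1 t)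
  refine ⟨fun t => (1 / 8) * (d0 t * d1 t * d2 t - t ^ 2 * (d0 t * o12 t * o21 t +
    o01 t * o10 t * d2 t + o02 t * d1 t * o20 t) + t ^ 3 * (o01 t * o12 t * o20 t +
    o02 t * o10 t * o21 t)), ?_, ?_, fun t => ?_⟩
  · have := hR 0 2; have := hR 1 3; have := hR 1 2; have := hR 0 3; have := hR 0 1
    have := hR 2 3; have := hJ 0 2; have := hJ 1 3; have := hJ 1 2; have := hJ 0 3
    have := hJ 0 1; have := hJ 2 3
    fun_prop
  · simp only [d0, d1, d2, hR0]
    ring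
  -- The constants `1` cancel in the diagonal differences. In the determinant the diagonal product
  -- has order 6, products with two off-diagonal entries order 8, and those with three order 9.
  · have hA : affineMatrix E α t s = (1 / 2 : ℝ) • !![t ^ 2 * d0 t, t ^ 3 * o01 t, t ^ 3 * o02 t;
        t ^ 3 * o10 t, t ^ 2 * d1 t, t ^ 3 * o12 t; t ^ 3 * o20 t, t ^ 3 * o21 t, t ^ 2 * d2 t] := by
      ext i j
      fin_cases i <;> fin_cases j <;>
        simp [affineMatrix, d0, d1, d2, o01, o02, o10, o12, o20, o21, hR', hJ'] <;> ring
    rw [hA, Matrix.det_smul, Matrix.det_fin_three]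
    simp
    ring

theorem analyticAt_det_affineMatrix (E : Bath N) (α : Fin 4 → ℝ) (s : Fin 3 → ℝ) :
    AnalyticAt ℝ (fun t => (affineMatrix E α t s).det) 0 := by
  obtain ⟨h, hh, -, hdet⟩ := exists_det_affineMatrix_eq E α s
  simp only [hdet]
  fun_prop

theorem iteratedDeriv_det_affineMatrix_eq_zero (E : Bath N) (α : Fin 4 → ℝ) (s : Fin 3 → ℝ) :
    ∀ k < 6, iteratedDeriv k (fun t => (affineMatrix E α t s).det) 0 = 0 := by
  obtain ⟨h, hh, -, hdet⟩ := exists_det_affineMatrix_eq E α s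
  have ha := analyticAt_det_affineMatrix E α s
  rw [← natCast_le_analyticOrderAt_iff_iteratedDeriv_eq_zero ha, natCast_le_analyticOrderAt ha]
  exact ⟨h, hh, Filter.Eventually.of_forall fun t => by simp [hdet]⟩

theorem exists_det_affineMatrix_eq_of_ne {E : Bath N} {α : Fin 4 → ℝ}
    (hg : ∃ i, E.g i ≠ 0) (h1 : (α 1 - α 3) ^ 2 ≠ (α 0 - α 2) ^ 2)
    (h2 : (α 0 - α 3) ^ 2 ≠ (α 1 - α 2) ^ 2) (h3 : (α 2 - α 3) ^ 2 ≠ (α 0 - α 1) ^ 2)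
    (s : Fin 3 → ℝ) : ∃ h : ℝ → ℝ, AnalyticAt ℝ h 0 ∧ h 0 ≠ 0 ∧
      ∀ t, (affineMatrix E α t s).det = t ^ 6 * h t := by
  obtain ⟨h, hh, h0, hdet⟩ := exists_det_affineMatrix_eq E α s
  refine ⟨h, hh, ?_, hdet⟩
  rw [h0]
  have := (decayRate_pos hg).ne'
  have := sub_ne_zero.2 h1
  have := sub_ne_zero.2 h2
  have := sub_ne_zero.2 h3
  positivity

theorem iteratedDeriv_det_affineMatrix_ne_zero {E : Bath N} {α : Fin 4 → ℝ}
    (hg : ∃ i, E.g i ≠ 0) (h1 : (α 1 - α 3) ^ 2 ≠ (α 0 - α 2) ^ 2)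
    (h2 : (α 0 - α 3) ^ 2 ≠ (α 1 - α 2) ^ 2) (h3 : (α 2 - α 3) ^ 2 ≠ (α 0 - α 1) ^ 2)
    (s : Fin 3 → ℝ) : iteratedDeriv 6 (fun t => (affineMatrix E α t s).det) 0 ≠ 0 := by
  obtain ⟨h, hh, hne, hdet⟩ := exists_det_affineMatrix_eq_of_ne hg h1 h2 h3 s
  have ha := analyticAt_det_affineMatrix E α s
  refine ((analyticOrderAt_eq_nat_iff_iteratedDeriv_eq_zero ha).1 ?_).2
  exact ha.analyticOrderAt_eq_natCast.2
    ⟨h, hh, hne, Filter.Eventually.of_forall fun t => by simp [hdet]⟩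

theorem exists_det_affineMatrix_ne_zero {E : Bath N} {α : Fin 4 → ℝ}
    (hg : ∃ i, E.g i ≠ 0) (h1 : (α 1 - α 3) ^ 2 ≠ (α 0 - α 2) ^ 2)
    (h2 : (α 0 - α 3) ^ 2 ≠ (α 1 - α 2) ^ 2) (h3 : (α 2 - α 3) ^ 2 ≠ (α 0 - α 1) ^ 2)
    (s : Fin 3 → ℝ) {T : ℝ} (hT : 0 < T) :
    ∃ t ∈ Set.Icc 0 T, (affineMatrix E α t s).det ≠ 0 := by
  obtain ⟨h, hh, hne, hdet⟩ := exists_det_affineMatrix_eq_of_ne hg h1 h2 h3 s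
  have hev : ∀ᶠ t in nhdsWithin 0 (Set.Ioi 0), h t ≠ 0 :=
    (hh.continuousAt.eventually_ne hne).filter_mono nhdsWithin_le_nhds
  obtain ⟨t, ht, ht'⟩ := (hev.and (Ioc_mem_nhdsGT hT)).exists
  refine ⟨t, ⟨ht'.1.le, ht'.2⟩, ?_⟩
  rw [hdet]
  exact mul_ne_zero (pow_ne_zero _ ht'.1.ne') ht

/-! ## Density matrices of a qubit -/

theorem conjTranspose_mul_ofBloch_mul (u : QubitBasis) (s : Fin 3 → ℝ) :
    (basisMat u)ᴴ * ofBloch u s * basisMat u = stdBloch s := by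
  have h := basisMat_conjTranspose_mul u
  rw [ofBloch_eq]
  calc _ = ((basisMat u)ᴴ * basisMat u) * stdBloch s * ((basisMat u)ᴴ * basisMat u) := by
        simp only [Matrix.mul_assoc]
    _ = _ := by rw [h, Matrix.one_mul, Matrix.mul_one]

/-- The coherence vector of a matrix with respect to the basis `u`. -/
noncomputable def blochVec (u : QubitBasis) (ρ : Matrix (Fin 2) (Fin 2) ℂ) : Fin 3 → ℝ :=
  let M := (basisMat u)ᴴ * ρ * basisMat u
  ![2 * (M 1 0).re, 2 * (M 1 0).im, (M 0 0).re - (M 1 1).re]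

theorem continuous_blochVec (u : QubitBasis) : Continuous (blochVec u) := by
  have h : Continuous fun ρ : Matrix (Fin 2) (Fin 2) ℂ => (basisMat u)ᴴ * ρ * basisMat u := by
    fun_prop
  have h' := fun i j => h.matrix_elem i j
  refine continuous_pi fun k => ?_
  fin_cases k
  · exact continuous_const.mul (Complex.continuous_re.comp (h' 1 0))
  · exact continuous_const.mul (Complex.continuous_im.comp (h' 1 0))
  · exact (Complex.continuous_re.comp (h' 0 0)).sub (Complex.continuous_re.comp (h' 1 1))

theorem blochVec_ofBloch (u : QubitBasis) (s : Fin 3 → ℝ) : blochVec u (ofBloch u s) = s := by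
  ext k
  simp only [blochVec, conjTranspose_mul_ofBloch_mul]
  fin_cases k <;> simp [stdBloch]
  ring

theorem ofBloch_blochVec (u : QubitBasis) {ρ : Matrix (Fin 2) (Fin 2) ℂ}
    (hρ : ρ ∈ densityMatrices) : ofBloch u (blochVec u ρ) = ρ := by
  set M := (basisMat u)ᴴ * ρ * basisMat u with hM
  have hH : M.IsHermitian := (hρ.1.conjTranspose_mul_mul_same (basisMat u)).1
  have htr : M.trace = 1 := by
    rw [hM, Matrix.trace_mul_comm, ← Matrix.mul_assoc, basisMat_mul_conjTranspose, Matrix.one_mul,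
      hρ.2]
  have hstd : stdBloch (blochVec u ρ) = M := by
    have h00 := congrFun (congrFun hH 0) 0
    have h11 := congrFun (congrFun hH 1) 1
    have h01 := congrFun (congrFun hH 0) 1
    simp only [Matrix.conjTranspose_apply, RCLike.star_def, Matrix.trace_fin_two] at h00 h11 h01 htr
    have i00 := Complex.conj_eq_iff_im.1 h00
    have i11 := Complex.conj_eq_iff_im.1 h11
    have r := congrArg Complex.re htr
    simp only [Complex.add_re, Complex.one_re] at r
    ext i j
    fin_cases i <;> fin_cases j <;> apply Complex.ext <;>
      simp [stdBloch, blochVec, ← hM, ← h01, i00, i11] <;> linarith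
  rw [ofBloch_eq, hstd, hM]
  have h := basisMat_mul_conjTranspose u
  calc _ = (basisMat u * (basisMat u)ᴴ) * ρ * (basisMat u * (basisMat u)ᴴ) := by
        simp only [Matrix.mul_assoc]
    _ = ρ := by rw [h, Matrix.one_mul, Matrix.mul_one]

/-- Positivity forces the determinant `(1 - |s|²) / 4` to be nonnegative. -/
theorem blochVec_mem_blochBall (u : QubitBasis) {ρ : Matrix (Fin 2) (Fin 2) ℂ}
    (hρ : ρ ∈ densityMatrices) : blochVec u ρ ∈ blochBall := by
  have h1 := hρ.1.conjTranspose_mul_mul_same (basisMat u)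
  rw [← ofBloch_blochVec u hρ, conjTranspose_mul_ofBloch_mul] at h1
  set s := blochVec u ρ
  have h2 := (Complex.le_def.1 h1.det_nonneg).1
  have h3 : (stdBloch s).det = ((1 / 4 * (1 - ∑ k, s k ^ 2) : ℝ) : ℂ) := by
    rw [Matrix.det_fin_two, Fin.sum_univ_three]
    simp [stdBloch]
    ring_nf
    simp only [Complex.I_sq]
    ring
  rw [h3] at h2
  simp only [Complex.zero_re, Complex.ofReal_re] at h2
  simp only [blochBall, Set.mem_ofPred_eq]
  linarith

/-- The quadratic form at `x` is `(|x|² + s · r) / 2`, where `r` is the unnormalised Bloch vector of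
`x`, of length `|x|²`; Cauchy–Schwarz concludes. -/
theorem posSemidef_stdBloch {s : Fin 3 → ℝ} (hs : s ∈ blochBall) : (stdBloch s).PosSemidef := by
  refine Matrix.PosSemidef.of_dotProduct_mulVec_nonneg ?_ fun x => ?_
  · ext i j
    fin_cases i <;> fin_cases j <;>
      simp [stdBloch, sub_eq_add_neg]
  · simp only [blochBall, Set.mem_ofPred_eq, Fin.sum_univ_three] at hs
    obtain ⟨a, b, hab⟩ : ∃ a b : ℝ, x 0 = a + b * Complex.I := ⟨_, _, (Complex.re_add_im _).symm⟩
    obtain ⟨c, d, hcd⟩ : ∃ c d : ℝ, x 1 = c + d * Complex.I := ⟨_, _, (Complex.re_add_im _).symm⟩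
    have he : star x ⬝ᵥ (stdBloch s).mulVec x = (((1 / 2) * ((a ^ 2 + b ^ 2 + c ^ 2 + d ^ 2) +
        (s 0 * (2 * (a * c + b * d)) + s 1 * (2 * (a * d - b * c)) +
          s 2 * (a ^ 2 + b ^ 2 - c ^ 2 - d ^ 2))) : ℝ) : ℂ) := by
      simp [dotProduct, Matrix.mulVec, stdBloch, Fin.sum_univ_two, hab, hcd]
      ring_nf
      simp only [Complex.I_sq]
      ring
    rw [he]
    refine Complex.zero_le_real.2 (mul_nonneg (by norm_num) ?_)
    set n := a ^ 2 + b ^ 2 + c ^ 2 + d ^ 2 with hn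
    set r0 := 2 * (a * c + b * d) with hr0
    set r1 := 2 * (a * d - b * c) with hr1
    set r2 := a ^ 2 + b ^ 2 - c ^ 2 - d ^ 2 with hr2
    have hr : r0 ^ 2 + r1 ^ 2 + r2 ^ 2 = n ^ 2 := by rw [hr0, hr1, hr2, hn]; ring
    have hn0 : 0 ≤ n := by positivity
    have hsq : (s 0 * r0 + s 1 * r1 + s 2 * r2) ^ 2 ≤ n ^ 2 := by
      calc (s 0 * r0 + s 1 * r1 + s 2 * r2) ^ 2
          ≤ (s 0 ^ 2 + s 1 ^ 2 + s 2 ^ 2) * (r0 ^ 2 + r1 ^ 2 + r2 ^ 2) := by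
            nlinarith [sq_nonneg (s 0 * r1 - s 1 * r0), sq_nonneg (s 0 * r2 - s 2 * r0),
              sq_nonneg (s 1 * r2 - s 2 * r1)]
        _ ≤ 1 * n ^ 2 := by rw [hr]; gcongr
        _ = n ^ 2 := one_mul _
    have := (abs_le_of_sq_le_sq' hsq hn0).1
    linarith

theorem ofBloch_mem_densityMatrices (u : QubitBasis) {s : Fin 3 → ℝ} (hs : s ∈ blochBall) :
    ofBloch u s ∈ densityMatrices := by
  rw [ofBloch_eq]
  refine ⟨(posSemidef_stdBloch hs).mul_mul_conjTranspose_same _, ?_⟩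
  rw [Matrix.trace_mul_comm, ← Matrix.mul_assoc, basisMat_conjTranspose_mul, Matrix.one_mul,
    Matrix.trace_fin_two]
  simp [stdBloch]
  ring

/-! ## Accessibility -/

theorem decay_nonneg (E : Bath N) (t : ℝ) : 0 ≤ decay E t :=
  Finset.sum_nonneg fun i _ => by
    have := meanOccupation_pos E i
    have := Real.cos_le_one (E.omega i * t)
    have : 0 ≤ 1 - Real.cos (E.omega i * t) := by linarith
    positivity

theorem norm_gam_le_one (E : Bath N) (α : Fin 4 → ℝ) (i j : Fin 4) (t : ℝ) :
    ‖gam E α i j t‖ ≤ 1 := by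
  rw [gam, Complex.norm_exp, Real.exp_le_one_iff]
  have := mul_nonneg (sq_nonneg (α i - α j)) (decay_nonneg E t)
  simp only [Complex.add_re, Complex.ofReal_re, Complex.mul_re, Complex.I_re, Complex.I_im,
    Complex.ofReal_im]
  linarith

/-- Since `|γ_ij| ≤ 1`, each coordinate of `s` is contracted. This ensures that the image of `p =
0`, the centre of the reached set, is a state. -/
theorem affineVector_mem_blochBall (E : Bath N) (α : Fin 4 → ℝ) (t : ℝ) {s : Fin 3 → ℝ}
    (hs : s ∈ blochBall) : affineVector E α t s ∈ blochBall := by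
  have h : ∀ (x : ℝ) (i j k l : Fin 4),
      ((1 / 2) * x * (gam E α i j t + gam E α k l t).re) ^ 2 ≤ x ^ 2 := by
    intro x i j k l
    have h1 := (Complex.abs_re_le_norm (gam E α i j t + gam E α k l t)).trans
      ((norm_add_le _ _).trans (add_le_add (norm_gam_le_one E α i j t) (norm_gam_le_one E α k l t)))
    rw [sq_le_sq, abs_mul, abs_mul, abs_of_pos (by norm_num : (0 : ℝ) < 1 / 2)]
    nlinarith [abs_nonneg x]
  simp only [blochBall, Set.mem_ofPred_eq] at hs ⊢
  refine le_trans (Finset.sum_le_sum fun k _ => ?_) hs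
  fin_cases k
  · exact h _ _ _ _ _
  · exact h _ _ _ _ _
  · exact h _ _ _ _ _

theorem isAccessible {E : Bath N} {AT : Matrix SP SP ℂ} {u v : QubitBasis} {α : Fin 4 → ℝ}
    {X : ℝ → Total N →L[ℂ] Total N} (hX : IsPropagator E AT X)
    (hBell : ∀ i, AT.mulVec (bell u v i) = (α i : ℂ) • bell u v i)
    (hg : ∃ i, E.g i ≠ 0) (h1 : (α 1 - α 3) ^ 2 ≠ (α 0 - α 2) ^ 2)
    (h2 : (α 0 - α 3) ^ 2 ≠ (α 1 - α 2) ^ 2) (h3 : (α 2 - α 3) ^ 2 ≠ (α 0 - α 1) ^ 2) :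
    IsAccessible E X := by
  intro T hT ρS hρS
  set s := blochVec u ρS with hs
  have hsρ : ofBloch u s = ρS := ofBloch_blochVec u hρS
  obtain ⟨t, ht, hdet⟩ := exists_det_affineMatrix_ne_zero hg h1 h2 h3 s hT
  set M := affineMatrix E α t s
  set a := affineVector E α t s
  have ha : a ∈ blochBall := affineVector_mem_blochBall E α t (blochVec_mem_blochBall u hρS)
  let c : Matrix (Fin 2) (Fin 2) ℂ → Fin 3 → ℝ := fun ρ => M⁻¹.mulVec (blochVec u ρ - a)
  have hc : Continuous c :=
    continuous_const.matrix_mulVec ((continuous_blochVec u).sub continuous_const)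
  -- `c ρ` is the probe vector needed to reach `ρ` at time `t`; the open set asks that it lie in the
  -- open unit ball. It contains `ofBloch u a`, where `c` vanishes.
  refine ⟨{ρ | ∑ k, c ρ k ^ 2 < 1}, ?_, ⟨ofBloch u a, ?_, ofBloch_mem_densityMatrices u ha⟩, ?_⟩
  · refine isOpen_lt (continuous_finsetSum _ fun k _ => ?_) continuous_const
    exact ((continuous_apply k).comp hc).pow 2
  · simp [c, blochVec_ofBloch]
  · rintro ρ ⟨hρ, hρd⟩
    refine Set.mem_biUnion ht ⟨ofBloch v (c ρ), ofBloch_mem_densityMatrices v ?_, ?_⟩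
    · exact le_of_lt (α := ℝ) hρ
    have hMc : M.mulVec (c ρ) + a = blochVec u ρ := by
      simp only [c]
      rw [Matrix.mulVec_mulVec, Matrix.mul_nonsing_inv _ (isUnit_iff_ne_zero.2 hdet),
        Matrix.one_mulVec, sub_add_cancel]
    rw [← hsρ, evolve_ofBloch hX hBell, hMc, ofBloch_blochVec u hρd]

end IncoherentControl

theorem mainTheorem1 {N : ℕ} (E : IncoherentControl.Bath N)
    (AT : Matrix IncoherentControl.SP IncoherentControl.SP ℂ) (hAT : AT.IsHermitian)
    (u v : IncoherentControl.QubitBasis) (α : Fin 4 → ℝ)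
    (hBell : ∀ i, AT.mulVec (IncoherentControl.bell u v i) =
      (α i : ℂ) • IncoherentControl.bell u v i)
    (X : ℝ → IncoherentControl.Total N →L[ℂ] IncoherentControl.Total N)
    (hX : IncoherentControl.IsPropagator E AT X) :
    (∀ (t : ℝ), ∀ s₀ ∈ IncoherentControl.blochBall, ∀ p ∈ IncoherentControl.blochBall,
      IncoherentControl.evolve E X t
          (IncoherentControl.ofBloch u s₀) (IncoherentControl.ofBloch v p) =
        IncoherentControl.ofBloch u
          ((IncoherentControl.affineMatrix E α t s₀).mulVec p +
            IncoherentControl.affineVector E α t s₀)) ∧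
    (∀ s₀ ∈ IncoherentControl.blochBall, ∀ k < 6,
      iteratedDeriv k (fun t => (IncoherentControl.affineMatrix E α t s₀).det) 0 = 0) ∧
    ((∃ i, E.g i ≠ 0) →
      (α 1 - α 3) ^ 2 ≠ (α 0 - α 2) ^ 2 →
      (α 0 - α 3) ^ 2 ≠ (α 1 - α 2) ^ 2 →
      (α 2 - α 3) ^ 2 ≠ (α 0 - α 1) ^ 2 →
      (∀ s₀ ∈ IncoherentControl.blochBall,
        iteratedDeriv 6 (fun t => (IncoherentControl.affineMatrix E α t s₀).det) 0 ≠ 0) ∧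
      IncoherentControl.IsAccessible E X) :=
  ⟨fun t s₀ _ p _ => IncoherentControl.evolve_ofBloch hX hBell t s₀ p,
    fun s₀ _ => IncoherentControl.iteratedDeriv_det_affineMatrix_eq_zero E α s₀,
    fun hg h1 h2 h3 =>
      ⟨fun s₀ _ => IncoherentControl.iteratedDeriv_det_affineMatrix_ne_zero hg h1 h2 h3 s₀,
        IncoherentControl.isAccessible hX hBell hg h1 h2 h3⟩⟩
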